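/- Let $n_0,d\ge 1$, $n=n_0d$ and $0<k<n$. Let $\Pi_{n_0}$ be the complete preprojective algebra over $\mathbb C$ of the cyclic quiver with vertices $1,\dots,n_0$ (modulo $n_0$), arrows $x_i:i-1\to i$, $y_i:i\to i-1$ (composed from right to left) and relations $xy=yx$, where $x=\sum_i x_i$, $y=\sum_i y_i$, completed at the arrow ideal; put $B_G=\Pi_{n_0}/(x^k-y^{n-k})$. For $k$-subsets $I,J$ of $\{1,\dots,n\}$ (read modulo $n$) write $I\sim_{n_0}J$ if $J=I+jn_0$ for some integer $j$, and let $[I]_{n_0}$ be the class of $I$. Let $L_{[I]_{n_0}}=\bigoplus_{l=0}^{d-1}\bigoplus_{i=1}^{n_0}\mathbb C[[t]]\,\mathbf 1_i^l$ (upper indices modulo $d$), with the convention $\mathbf 1_0^{l}=\mathbf 1_{n_0}^{l-1}$, be the left $B_G$-module in which $e_i$ is the projection onto $\bigoplus_l\mathbb C[[t]]\mathbf 1_i^l$; $x_i$ maps $\mathbf 1_{i-1}^l$ to $\mathbf 1_i^l$ if $i+ln_0\in I$ and to $t\mathbf 1_i^l$ otherwise; $y_i$ maps $\mathbf 1_i^l$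 to $t\mathbf 1_{i-1}^l$ if $i+ln_0\in I$ and to $\mathbf 1_{i-1}^l$ otherwise; $x_i$ and $y_i$ kill the other basis vectors. (The module depends on the representative $I$ of the class.) (a) For all $k$-subsets $I,J$ of $\{1,\dots,n\}$, and for every choice of the representatives $I$, $J$ of their classes, $L_{[I]_{n_0}}\cong L_{[J]_{n_0}}$ as $B_G$-modules if and only if $[I]_{n_0}=[J]_{n_0}$. (b) Consider a closed disk with an interior orbifold point $\Omega$ of order $d>1$ and marked boundary points $1,\dots,n_0$ in clockwise order. Winding numbers are taken around $\Omega$, clockwise. An orbifold diagram $\mathcal O$ of order $d$ and type $\tau\in S_{n_0}$ consists of smooth regular oriented strands $\gamma_1,\dots,\gamma_{n_0}$, where $\gamma_i$ runs from $i$ to $\tau(i)$, meets the boundary only there and avoids $\Omega$, such that (crossings at marked points and self-crossings included): there are finitely many crossings, all transverse double points; along each strand, crossings come alternately from the left and from the right; if two different strands pass through points $A$ and $B$, both oriented from $A$ to $B$, the loop formed by the two arcs has nonzero winding number; for a self-crossing of a strand, the resulting loop has nonzero winding number or is simple and not met by another strand; and all these winding numbers are $<d$ in absolute value. It is Grassmannian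 of type $(k,n)$ if $\tau=\mathrm{id}$ and there is an integer $0<w<d$ with $k=n_0w$ such that every strand has winding number $w$ or $w-d$. Let $\mathrm{sym}_d(\mathcal O)$ be the diagram of $n$ strands on a disk obtained by gluing $d$ copies of $\mathcal O$ along a curve from $\Omega$ to the boundary arc between $n_0$ and $1$ (the preimage of $\mathcal O$ under $z\mapsto z^d$), with marked points $1,\dots,n$ clockwise. A region (component of the complement of the strands in the disk) is alternating if it touches the boundary circle or if the strands adjacent to it do not orient its boundary cyclically. Its label is the set of those $i$ for which the region lies to the left of the strand starting at $i$, that is, in the component of the complement of this strand that is adjacent, on the left, to its initial part. Let $\mathcal I_{\mathcal O}$ be the set of classes $[I]_{n_0}$ of the $k$-subsets $I$ that are labels of alternating regions of $\mathrm{sym}_d(\mathcal O)$, and let $T_{\mathcal O}=\bigoplus_{[I]_{n_0}\in\mathcal I_{\mathcal O}}L_{[I]_{n_0}}$. Then for every Grassmannian orbifold diagram $\mathcal O$ of order $d$ and type $(k,n)$, the $B_G$-module $T_{\mathcal O}$ is basic: it is a finite direct sum of pairwise non-isomorphic indecomposable $B_G$-modules. -/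

import Mathlib

open scoped PowerSeries ContDiff Topology

noncomputable section

namespace OrbifoldDiagrams

/-! ## Basic and indecomposable modules -/

/-- A module is indecomposable if it is nonzero and is not the direct sum of two nonzero
submodules. -/
def IsIndecomposable (R M : Type*) [Ring R] [AddCommGroup M] [Module R M] : Prop :=
  Nontrivial M ∧ ∀ P Q : Submodule R M, IsCompl P Q → P = ⊥ ∨ Q = ⊥

/-- A module is basic if it is a finite direct sum of pairwise non-isomorphic indecomposable
submodules. -/
def IsBasic (R M : Type*) [Ring R] [AddCommGroup M] [Module R M] : Prop :=
  ∃ (r : ℕ) (N : Fin r → Submodule R M), DirectSum.IsInternal N ∧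
    (∀ i, IsIndecomposable R (N i)) ∧ ∀ i j, i ≠ j → IsEmpty (N i ≃ₗ[R] N j)

/-! ## The algebra `B_G` -/

/-- The vertices `i` (idempotents `e i`) and the arrows `x i : i - 1 → i`, `y i : i → i - 1` of the
double of the cyclic quiver with `m` vertices. The vertices are the residues modulo `m`, so that
the vertex `m` is the residue `0`. -/
inductive Gen (m : ℕ) : Type
  | e (i : ZMod m) : Gen m
  | x (i : ZMod m) : Gen m
  | y (i : ZMod m) : Gen m

/-- The relations of the path algebra (arrows are composed from right to left), followed by the
preprojective relation `x y = y x` at every vertex. -/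
inductive Rel (m : ℕ) [NeZero m] : FreeAlgebra ℂ (Gen m) → FreeAlgebra ℂ (Gen m) → Prop
  | idem (i : ZMod m) :
      Rel m (FreeAlgebra.ι ℂ (Gen.e i) * FreeAlgebra.ι ℂ (Gen.e i)) (FreeAlgebra.ι ℂ (Gen.e i))
  | orth (i j : ZMod m) (h : i ≠ j) :
      Rel m (FreeAlgebra.ι ℂ (Gen.e i) * FreeAlgebra.ι ℂ (Gen.e j)) 0
  | sum_e : Rel m (∑ i : ZMod m, FreeAlgebra.ι ℂ (Gen.e i)) 1
  | x_source (i : ZMod m) :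
      Rel m (FreeAlgebra.ι ℂ (Gen.x i) * FreeAlgebra.ι ℂ (Gen.e (i - 1)))
        (FreeAlgebra.ι ℂ (Gen.x i))
  | x_target (i : ZMod m) :
      Rel m (FreeAlgebra.ι ℂ (Gen.e i) * FreeAlgebra.ι ℂ (Gen.x i)) (FreeAlgebra.ι ℂ (Gen.x i))
  | y_source (i : ZMod m) :
      Rel m (FreeAlgebra.ι ℂ (Gen.y i) * FreeAlgebra.ι ℂ (Gen.e i)) (FreeAlgebra.ι ℂ (Gen.y i))
  | y_target (i : ZMod m) :
      Rel m (FreeAlgebra.ι ℂ (Gen.e (i - 1)) * FreeAlgebra.ι ℂ (Gen.y i))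
        (FreeAlgebra.ι ℂ (Gen.y i))
  | preproj (i : ZMod m) :
      Rel m (FreeAlgebra.ι ℂ (Gen.x i) * FreeAlgebra.ι ℂ (Gen.y i))
        (FreeAlgebra.ι ℂ (Gen.y (i + 1)) * FreeAlgebra.ι ℂ (Gen.x (i + 1)))

/-- The (uncompleted) preprojective algebra of the cyclic quiver with `m` vertices, over `ℂ`. -/
def Preproj (m : ℕ) [NeZero m] : Type := RingQuot (Rel m)

instance (m : ℕ) [NeZero m] : Ring (Preproj m) := inferInstanceAs (Ring (RingQuot (Rel m)))

instance (m : ℕ) [NeZero m] : Algebra ℂ (Preproj m) :=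
  inferInstanceAs (Algebra ℂ (RingQuot (Rel m)))

/-- The image in the preprojective algebra of a vertex or an arrow. -/
def Preproj.gen (m : ℕ) [NeZero m] (g : Gen m) : Preproj m :=
  RingQuot.mkAlgHom ℂ (Rel m) (FreeAlgebra.ι ℂ g)

/-- The completion `lim A / 𝔪 ^ q` of a (not necessarily commutative) algebra at a two-sided
ideal. -/
def adicLimit (A : Type*) [Ring A] [Algebra ℂ A] (𝔪 : Ideal A) [𝔪.IsTwoSided] :
    Subalgebra ℂ (∀ q : ℕ, A ⧸ 𝔪 ^ q) where
  carrier := {a | ∀ p q (h : p ≤ q), Ideal.Quotient.factor (Ideal.pow_le_pow_right h) (a q) = a p}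
  mul_mem' ha hb p q h := by rw [Pi.mul_apply, Pi.mul_apply, map_mul, ha p q h, hb p q h]
  add_mem' ha hb p q h := by rw [Pi.add_apply, Pi.add_apply, map_add, ha p q h, hb p q h]
  algebraMap_mem' r p q h := rfl

/-- The canonical map from an algebra to its completion. -/
def adicLimit.of (A : Type*) [Ring A] [Algebra ℂ A] (𝔪 : Ideal A) [𝔪.IsTwoSided] :
    A →ₐ[ℂ] adicLimit A 𝔪 where
  toFun a := ⟨fun _ => Ideal.Quotient.mk _ a, fun _ _ _ => rfl⟩
  map_one' := rfl
  map_mul' _ _ := rfl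
  map_zero' := rfl
  map_add' _ _ := rfl
  commutes' _ := rfl

/-- The two-sided ideal generated by all arrows. -/
def arrowIdeal (m : ℕ) [NeZero m] : Ideal (Preproj m) :=
  (TwoSidedIdeal.span {a | ∃ i, a = Preproj.gen m (Gen.x i) ∨ a = Preproj.gen m (Gen.y i)}).asIdeal

instance (m : ℕ) [NeZero m] : (arrowIdeal m).IsTwoSided := by
  unfold arrowIdeal; infer_instance

/-- The complete preprojective algebra `Π_m`: the completion of the preprojective algebra at the
arrow ideal. -/
def CompletePreproj (m : ℕ) [NeZero m] : Type := adicLimit (Preproj m) (arrowIdeal m)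

instance (m : ℕ) [NeZero m] : Ring (CompletePreproj m) :=
  inferInstanceAs (Ring (adicLimit (Preproj m) (arrowIdeal m)))

instance (m : ℕ) [NeZero m] : Algebra ℂ (CompletePreproj m) :=
  inferInstanceAs (Algebra ℂ (adicLimit (Preproj m) (arrowIdeal m)))

/-- The image in `Π_m` of a vertex or an arrow. -/
def CompletePreproj.gen (m : ℕ) [NeZero m] (g : Gen m) : CompletePreproj m :=
  adicLimit.of (Preproj m) (arrowIdeal m) (Preproj.gen m g)

/-- The element `x = ∑ x_i` of the complete preprojective algebra. -/
def xTot (m : ℕ) [NeZero m] : CompletePreproj m :=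
  ∑ i : ZMod m, CompletePreproj.gen m (Gen.x i)

/-- The element `y = ∑ y_i` of the complete preprojective algebra. -/
def yTot (m : ℕ) [NeZero m] : CompletePreproj m :=
  ∑ i : ZMod m, CompletePreproj.gen m (Gen.y i)

/-- The two-sided ideal of `Π_{n₀}` generated by `x ^ k - y ^ (n - k)`, with `n = n₀ d`. (The
relations at the single vertices are obtained by multiplication with the idempotents.) -/
def relIdeal (n₀ d k : ℕ) [NeZero n₀] : Ideal (CompletePreproj n₀) :=
  (TwoSidedIdeal.span {xTot n₀ ^ k - yTot n₀ ^ (n₀ * d - k)}).asIdeal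

instance (n₀ d k : ℕ) [NeZero n₀] : (relIdeal n₀ d k).IsTwoSided := by
  unfold relIdeal; infer_instance

/-- The algebra `B_G(n₀, k, n)`, `n = n₀ d`. -/
def BG (n₀ d k : ℕ) [NeZero n₀] : Type := CompletePreproj n₀ ⧸ relIdeal n₀ d k

instance (n₀ d k : ℕ) [NeZero n₀] : Ring (BG n₀ d k) :=
  inferInstanceAs (Ring (CompletePreproj n₀ ⧸ relIdeal n₀ d k))

instance (n₀ d k : ℕ) [NeZero n₀] : Algebra ℂ (BG n₀ d k) :=
  inferInstanceAs (Algebra ℂ (CompletePreproj n₀ ⧸ relIdeal n₀ d k))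

/-- The projection from `Π_{n₀}` to `B_G`. -/
def BG.mk (n₀ d k : ℕ) [NeZero n₀] : CompletePreproj n₀ →+* BG n₀ d k :=
  Ideal.Quotient.mk (relIdeal n₀ d k)

/-- The image in `B_G` of a vertex or an arrow. -/
def BG.gen (n₀ d k : ℕ) [NeZero n₀] (g : Gen n₀) : BG n₀ d k :=
  BG.mk n₀ d k (CompletePreproj.gen n₀ g)

/-! ## `k`-subsets and their classes -/

/-- The `k`-element subsets of `{1, …, n}`, regarded as the set of residues modulo `n`. -/
abbrev KSubset (n k : ℕ) : Type := {I : Finset (ZMod n) // I.card = k}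

/-- The relation `I ∼_{n₀} J`: the set `J` arises from `I` by adding a multiple `j n₀` to every
element. -/
def rotSetoid (n₀ d k : ℕ) : Setoid (KSubset (n₀ * d) k) where
  r I J := ∃ j : ℤ, ∀ a : ZMod (n₀ * d), a ∈ I.1 ↔ a + (j : ZMod (n₀ * d)) * n₀ ∈ J.1
  iseqv :=
    { refl := fun I => ⟨0, fun a => by simp⟩
      symm := fun {I J} ⟨j, h⟩ => ⟨-j, fun a => by
        rw [h (a + ((-j : ℤ) : ZMod (n₀ * d)) * n₀)]
        push_cast
        ring_nf⟩
      trans := fun {I J K} ⟨j, h⟩ ⟨j', h'⟩ => ⟨j + j', fun a => by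
        rw [h a, h']
        push_cast
        ring_nf⟩ }

/-- The set of equivalence classes `[I]_{n₀}` of `k`-subsets of `{1, …, n₀ d}`. -/
abbrev SubsetClass (n₀ d k : ℕ) : Type := Quotient (rotSetoid n₀ d k)

/-- The class `[I]_{n₀}`. -/
def cls (n₀ : ℕ) {d k : ℕ} (I : KSubset (n₀ * d) k) : SubsetClass n₀ d k :=
  Quotient.mk (rotSetoid n₀ d k) I

/-! ## The modules `L_{[I]}` -/

/-- The reduction `{1, …, n₀ d} → {1, …, n₀}` modulo `n₀`. -/
def red (n₀ d : ℕ) : ZMod (n₀ * d) →+* ZMod n₀ := ZMod.castHom (Dvd.intro d rfl) (ZMod n₀)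

/-- `t ^ [p]`, for the variable `t` of the power series ring. -/
def tIf (p : Prop) : ℂ⟦X⟧ :=
  haveI := Classical.dec p
  if p then PowerSeries.X else 1

/-- The free `ℂ⟦t⟧`-module `⨁_{l < d} ⨁_{i ≤ n₀} ℂ⟦t⟧`. The basis vector `𝟏_i^l`
(`1 ≤ i ≤ n₀`, `l` modulo `d`) has the index `i + l n₀` in `ℤ / n₀ d`; every index is of that
form for exactly one pair `(i, l)`. -/
abbrev Carrier (n₀ d : ℕ) : Type := ZMod (n₀ * d) → ℂ⟦X⟧

/-- The action of vertices and arrows on `L_{[I]}`. On basis vectors, for an index `j = i + l n₀`: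
`e_i 𝟏_j = 𝟏_j`; `x_i 𝟏_{j-1} = 𝟏_j` if `j ∈ I` and `t 𝟏_j` if `j ∉ I`; `y_i 𝟏_j = 𝟏_{j-1}` if
`j ∉ I` and `t 𝟏_{j-1}` if `j ∈ I`; everything else is mapped to zero. For `i = 1` the index
`j - 1 = n₀ + (l - 1) n₀` is that of `𝟏_{n₀}^{l-1}`. -/
def genAct (n₀ d : ℕ) (I : Finset (ZMod (n₀ * d))) : Gen n₀ → Module.End ℂ⟦X⟧ (Carrier n₀ d)
  | .e i =>
    { toFun := fun v j => if red n₀ d j = i then v j else 0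
      map_add' := fun v w => by funext j; by_cases h : red n₀ d j = i <;> simp [h]
      map_smul' := fun c v => by funext j; by_cases h : red n₀ d j = i <;> simp [h] }
  | .x i =>
    { toFun := fun v j => if red n₀ d j = i then tIf (j ∉ I) * v (j - 1) else 0
      map_add' := fun v w => by funext j; by_cases h : red n₀ d j = i <;> simp [h, mul_add]
      map_smul' := fun c v => by
        funext j; by_cases h : red n₀ d j = i <;> simp [h, mul_left_comm] }
  | .y i =>
    { toFun := fun v j => if red n₀ d (j + 1) = i then tIf (j + 1 ∈ I) * v (j + 1) else 0
      map_add' := fun v w => by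
        funext j; by_cases h : red n₀ d (j + 1) = i <;> simp [h, mul_add, -map_add]
      map_smul' := fun c v => by
        funext j; by_cases h : red n₀ d (j + 1) = i <;> simp [h, mul_left_comm, -map_add] }

lemma tIf_not_mul (p : Prop) : tIf (¬ p) * tIf p = PowerSeries.X := by
  by_cases h : p <;> simp [tIf, h]

lemma tIf_mul_not (p : Prop) : tIf p * tIf (¬ p) = PowerSeries.X := by
  rw [mul_comm, tIf_not_mul]

lemma genAct_rel (n₀ d : ℕ) [NeZero n₀] (I : Finset (ZMod (n₀ * d)))
    ⦃a b : FreeAlgebra ℂ (Gen n₀)⦄ (h : Rel n₀ a b) :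
    FreeAlgebra.lift ℂ (genAct n₀ d I) a = FreeAlgebra.lift ℂ (genAct n₀ d I) b := by
  cases h with
  | idem i => ext1 v; funext j; by_cases h : red n₀ d j = i <;> simp [genAct, h]
  | orth i i' h =>
    ext1 v; funext j
    by_cases h1 : red n₀ d j = i
    · have h2 : red n₀ d j ≠ i' := h1 ▸ h
      simp [genAct, h2]
    · simp [genAct, h1]
  | sum_e => ext1 v; funext j; simp [genAct, LinearMap.sum_apply, Finset.sum_apply]
  | x_source i => ext1 v; funext j; by_cases h : red n₀ d j = i <;> simp [genAct, h]
  | x_target i => ext1 v; funext j; by_cases h : red n₀ d j = i <;> simp [genAct, h]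
  | y_source i => ext1 v; funext j; by_cases h : red n₀ d j + 1 = i <;> simp [genAct, h]
  | y_target i =>
    ext1 v; funext j
    by_cases h : red n₀ d j + 1 = i
    · have h2 : red n₀ d j = i - 1 := eq_sub_of_add_eq h
      simp [genAct, h2]
    · simp [genAct, h]
  | preproj i =>
    ext1 v; funext j
    by_cases h : red n₀ d j = i
    · simp [genAct, h, ← mul_assoc, tIf_not_mul, tIf_mul_not]
    · simp [genAct, h]

/-- The action of the uncompleted preprojective algebra on `L_{[I]}`. -/
def preAct (n₀ d : ℕ) [NeZero n₀] (I : Finset (ZMod (n₀ * d))) :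
    Preproj n₀ →ₐ[ℂ] Module.End ℂ⟦X⟧ (Carrier n₀ d) :=
  RingQuot.liftAlgHom ℂ ⟨FreeAlgebra.lift ℂ (genAct n₀ d I), genAct_rel n₀ d I⟩

lemma preAct_gen (n₀ d : ℕ) [NeZero n₀] (I : Finset (ZMod (n₀ * d))) (g : Gen n₀) :
    preAct n₀ d I (Preproj.gen n₀ g) = genAct n₀ d I g := by
  unfold preAct Preproj.gen
  erw [RingQuot.liftAlgHom_mkAlgHom_apply]
  simp

/-! ### Extension of an action to the completion -/

section Extension

variable {A : Type*} [Ring A] [Algebra ℂ A] (𝔪 : Ideal A) [𝔪.IsTwoSided] {ι : Type*}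

/-- The action `ρ` of `A` on a power of `ℂ⟦t⟧` is continuous: all elements of the ideal `𝔪 ^ q`
act by zero modulo `t ^ (c + 1)` if `q ≥ Q c`. -/
def IsContinuousAction (ρ : A →ₐ[ℂ] Module.End ℂ⟦X⟧ (ι → ℂ⟦X⟧)) (Q : ℕ → ℕ) : Prop :=
  ∀ c q, Q c ≤ q → ∀ a ∈ 𝔪 ^ q, ∀ v i, PowerSeries.coeff c (ρ a v i) = 0

variable {𝔪}

/-- A representative in `A` of the component of level `q` of an element of the completion. -/
def repr (a : adicLimit A 𝔪) (q : ℕ) : A := (Ideal.Quotient.mk_surjective (a.1 q)).choose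

lemma mk_repr (a : adicLimit A 𝔪) (q : ℕ) : Ideal.Quotient.mk (𝔪 ^ q) (repr a q) = a.1 q :=
  (Ideal.Quotient.mk_surjective (a.1 q)).choose_spec

lemma mk_repr_of_le (a : adicLimit A 𝔪) {p q : ℕ} (h : p ≤ q) :
    Ideal.Quotient.mk (𝔪 ^ p) (repr a q) = a.1 p := by
  rw [← a.2 p q h, ← mk_repr a q]; rfl

/-- The action of an element `a` of the completion: the coefficient at `t ^ c` is that for any
representative of the component of `a` of a level `q ≥ Q c`. -/
def extFun (ρ : A →ₐ[ℂ] Module.End ℂ⟦X⟧ (ι → ℂ⟦X⟧)) (Q : ℕ → ℕ) (a : adicLimit A 𝔪)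
    (v : ι → ℂ⟦X⟧) : ι → ℂ⟦X⟧ :=
  fun i => PowerSeries.mk fun c => PowerSeries.coeff c (ρ (repr a (Q c)) v i)

variable {ρ : A →ₐ[ℂ] Module.End ℂ⟦X⟧ (ι → ℂ⟦X⟧)} {Q : ℕ → ℕ}

lemma coeff_congr (hρ : IsContinuousAction 𝔪 ρ Q) (c : ℕ) {a b : A}
    (h : Ideal.Quotient.mk (𝔪 ^ Q c) a = Ideal.Quotient.mk (𝔪 ^ Q c) b) (v : ι → ℂ⟦X⟧) (i : ι) :
    PowerSeries.coeff c (ρ a v i) = PowerSeries.coeff c (ρ b v i) := by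
  have h1 := hρ c (Q c) le_rfl (a - b) (Ideal.Quotient.eq.1 h) v i
  rw [map_sub, LinearMap.sub_apply, Pi.sub_apply, map_sub] at h1
  exact sub_eq_zero.1 h1

lemma coeff_extFun (hρ : IsContinuousAction 𝔪 ρ Q) (a : adicLimit A 𝔪) (c : ℕ) (b : A)
    (h : Ideal.Quotient.mk (𝔪 ^ Q c) b = a.1 (Q c)) (v : ι → ℂ⟦X⟧) (i : ι) :
    PowerSeries.coeff c (extFun ρ Q a v i) = PowerSeries.coeff c (ρ b v i) := by
  rw [extFun, PowerSeries.coeff_mk]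
  exact coeff_congr hρ c (by rw [mk_repr, h]) v i

lemma coeff_apply_congr (f : Module.End ℂ⟦X⟧ (ι → ℂ⟦X⟧)) (c : ℕ) {v w : ι → ℂ⟦X⟧}
    (h : ∀ c' ≤ c, ∀ i, PowerSeries.coeff c' (v i) = PowerSeries.coeff c' (w i)) (i : ι) :
    PowerSeries.coeff c (f v i) = PowerSeries.coeff c (f w i) := by
  have h1 : ∀ i, (PowerSeries.X : ℂ⟦X⟧) ^ (c + 1) ∣ v i - w i := fun i =>
    PowerSeries.X_pow_dvd_iff.2 fun m hm => by
      rw [map_sub, h m (Nat.lt_succ_iff.1 hm) i, sub_self]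
  choose u hu using h1
  have h2 : v = w + (PowerSeries.X : ℂ⟦X⟧) ^ (c + 1) • u := by
    funext i
    simp [← hu i]
  rw [h2, map_add, map_smul, Pi.add_apply, map_add, Pi.smul_apply, smul_eq_mul,
    PowerSeries.coeff_X_pow_mul', if_neg (by omega), add_zero]

/-- The extension of a continuous action of `A` to the completion of `A`. -/
def extAct (hQ : Monotone Q) (hρ : IsContinuousAction 𝔪 ρ Q) :
    adicLimit A 𝔪 →+* Module.End ℂ⟦X⟧ (ι → ℂ⟦X⟧) where
  toFun a :=
    { toFun := extFun ρ Q a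
      map_add' := fun v w => by
        funext i; ext c
        simp [extFun]
      map_smul' := fun r v => by
        funext i; ext c
        rw [coeff_extFun hρ a c _ (mk_repr a _), map_smul]
        simp only [Pi.smul_apply, smul_eq_mul, RingHom.id_apply, PowerSeries.coeff_mul]
        refine Finset.sum_congr rfl fun p hp => ?_
        rw [coeff_extFun hρ a p.2 (repr a (Q c))
          (mk_repr_of_le a (hQ (by have := Finset.HasAntidiagonal.mem_antidiagonal.1 hp; omega)))] }
  map_one' := by
    ext1 v; funext i; ext c
    change PowerSeries.coeff c (extFun ρ Q 1 v i) = _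
    rw [coeff_extFun hρ 1 c 1 rfl, map_one]
  map_mul' a b := by
    ext1 v; funext i; ext c
    change PowerSeries.coeff c (extFun ρ Q (a * b) v i) =
      PowerSeries.coeff c (extFun ρ Q a (extFun ρ Q b v) i)
    rw [coeff_extFun hρ (a * b) c (repr a (Q c) * repr b (Q c))
      (by rw [map_mul, mk_repr, mk_repr]; rfl), coeff_extFun hρ a c _ (mk_repr a _), map_mul]
    refine coeff_apply_congr (ρ (repr a (Q c))) c (fun c' hc' i' => ?_) i
    rw [coeff_extFun hρ b c' _ (mk_repr_of_le b (hQ hc'))]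
  map_zero' := by
    ext1 v; funext i; ext c
    change PowerSeries.coeff c (extFun ρ Q 0 v i) = _
    rw [coeff_extFun hρ 0 c 0 rfl, map_zero]
  map_add' a b := by
    ext1 v; funext i; ext c
    change PowerSeries.coeff c (extFun ρ Q (a + b) v i) =
      PowerSeries.coeff c (extFun ρ Q a v i + extFun ρ Q b v i)
    rw [coeff_extFun hρ (a + b) c (repr a (Q c) + repr b (Q c))
      (by rw [map_add, mk_repr, mk_repr]; rfl), map_add, map_add,
      coeff_extFun hρ a c _ (mk_repr a _), coeff_extFun hρ b c _ (mk_repr b _)]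
    simp

lemma extAct_of (hQ : Monotone Q) (hρ : IsContinuousAction 𝔪 ρ Q) (a : A) :
    extAct hQ hρ (adicLimit.of A 𝔪 a) = ρ a := by
  ext1 v; funext i; ext c
  exact coeff_extFun hρ (adicLimit.of A 𝔪 a) c a rfl v i

end Extension

/-! ### The action on `L_{[I]}` is continuous

The module is graded in such a way that `x` has degree `n - k`, `y` has degree `k` and `t` has
degree `n`. -/

/-- The degree of the basis vector of index `j`. -/
def wt (n k : ℕ) (I : Finset (ZMod n)) (j : ZMod n) : ℤ :=
  ∑ s ∈ Finset.range j.val, ((if ((s + 1 : ℕ) : ZMod n) ∈ I then (n : ℤ) else 0) - k)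

lemma wt_step (n k : ℕ) [NeZero n] (I : Finset (ZMod n)) (hI : I.card = k) (j : ZMod n) :
    wt n k I j = wt n k I (j - 1) + ((if j ∈ I then (n : ℤ) else 0) - k) := by
  have key : ∑ s ∈ Finset.range n, ((if ((s + 1 : ℕ) : ZMod n) ∈ I then (n : ℤ) else 0) - k)
      = 0 := by
    have h1 : ∑ s ∈ Finset.range n, (if ((s + 1 : ℕ) : ZMod n) ∈ I then (n : ℤ) else 0)
        = ∑ a : ZMod n, if a ∈ I then (n : ℤ) else 0 := by
      refine Finset.sum_bij (fun s _ => ((s + 1 : ℕ) : ZMod n)) (fun _ _ => Finset.mem_univ _)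
        ?_ ?_ (fun _ _ => rfl)
      · intro s hs s' hs' h
        push_cast at h
        have h := (ZMod.natCast_eq_natCast_iff' _ _ _).1 (add_right_cancel h)
        rwa [Nat.mod_eq_of_lt (Finset.mem_range.1 hs),
          Nat.mod_eq_of_lt (Finset.mem_range.1 hs')] at h
      · intro a _
        exact ⟨(a - 1).val, Finset.mem_range.2 (ZMod.val_lt _), by
          push_cast; rw [ZMod.natCast_zmod_val]; ring⟩
    rw [Finset.sum_sub_distrib, h1, ← Finset.sum_filter]
    simp [hI, mul_comm]
  have hj : ((((j - 1).val + 1 : ℕ)) : ZMod n) = j := by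
    push_cast; rw [ZMod.natCast_zmod_val]; ring
  have hs : wt n k I (j - 1) + ((if j ∈ I then (n : ℤ) else 0) - k) =
      ∑ s ∈ Finset.range ((j - 1).val + 1),
        ((if ((s + 1 : ℕ) : ZMod n) ∈ I then (n : ℤ) else 0) - k) := by
    rw [Finset.sum_range_succ, hj, wt]
  rw [hs]
  rcases (Nat.succ_le_of_lt (ZMod.val_lt (j - 1))).lt_or_eq with h | h
  · have : j.val = (j - 1).val + 1 := by
      conv_lhs => rw [← hj]
      exact ZMod.val_cast_of_lt h
    rw [wt, this]
  · have h0 : j = 0 := by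
      rw [← hj]
      have h' : (j - 1).val + 1 = n := h
      rw [h']; simp
    have h' : (j - 1).val + 1 = n := h
    rw [h', key, h0]
    simp [wt]

lemma abs_wt_le (n k : ℕ) [NeZero n] (I : Finset (ZMod n)) (hk : k ≤ n) (j : ZMod n) :
    |wt n k I j| ≤ (n : ℤ) * n := by
  refine (Finset.abs_sum_le_sum_abs _ _).trans ?_
  refine (Finset.sum_le_card_nsmul _ _ (n : ℤ) fun s _ => ?_).trans ?_
  · split_ifs <;> rw [abs_le] <;> constructor <;> omega
  · rw [Finset.card_range, nsmul_eq_mul]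
    have := (ZMod.val_lt j).le
    gcongr

/-- The vectors all of whose homogeneous components have degree at least `q`. -/
def Filt (n k : ℕ) (I : Finset (ZMod n)) (q : ℤ) (v : ZMod n → ℂ⟦X⟧) : Prop :=
  ∀ j c, PowerSeries.coeff c (v j) ≠ 0 → q ≤ wt n k I j + n * c

lemma Filt.add {n k : ℕ} {I : Finset (ZMod n)} {q : ℤ} {v w : ZMod n → ℂ⟦X⟧}
    (hv : Filt n k I q v) (hw : Filt n k I q w) : Filt n k I q (v + w) := by
  intro j c h
  by_cases h1 : PowerSeries.coeff c (v j) = 0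
  · refine hw j c fun h2 => h ?_
    rw [Pi.add_apply, map_add, h1, h2, add_zero]
  · exact hv j c h1

lemma Filt.zero (n k : ℕ) (I : Finset (ZMod n)) (q : ℤ) : Filt n k I q 0 := by
  intro j c h
  simp at h

lemma Filt.mono {n k : ℕ} {I : Finset (ZMod n)} {q q' : ℤ} (h : q' ≤ q) {v : ZMod n → ℂ⟦X⟧}
    (hv : Filt n k I q v) : Filt n k I q' v :=
  fun j c hc => h.trans (hv j c hc)

lemma coeff_tIf_mul (p : Prop) (c : ℕ) (f : ℂ⟦X⟧) (h : PowerSeries.coeff c (tIf p * f) ≠ 0) :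
    (¬ p ∧ PowerSeries.coeff c f ≠ 0) ∨ (p ∧ ∃ c', c = c' + 1 ∧ PowerSeries.coeff c' f ≠ 0) := by
  by_cases hp : p
  · right
    refine ⟨hp, ?_⟩
    cases c with
    | zero => simp [tIf, hp] at h
    | succ c' => exact ⟨c', rfl, by simpa [tIf, hp, PowerSeries.coeff_succ_X_mul] using h⟩
  · left
    exact ⟨hp, by simpa [tIf, hp] using h⟩

lemma genAct_filt {n₀ d k : ℕ} [NeZero n₀] [NeZero d] (I : Finset (ZMod (n₀ * d)))
    (hI : I.card = k) (hk : 0 < k) (hkn : k < n₀ * d) (q : ℤ) (v : Carrier n₀ d)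
    (hv : Filt (n₀ * d) k I q v) (i : ZMod n₀) :
    Filt (n₀ * d) k I q (genAct n₀ d I (.e i) v) ∧
    Filt (n₀ * d) k I (q + 1) (genAct n₀ d I (.x i) v) ∧
    Filt (n₀ * d) k I (q + 1) (genAct n₀ d I (.y i) v) := by
  refine ⟨fun j c h => ?_, fun j c h => ?_, fun j c h => ?_⟩
  · simp only [genAct, LinearMap.coe_mk, AddHom.coe_mk] at h
    split_ifs at h
    · exact hv j c h
    · simp at h
  · simp only [genAct, LinearMap.coe_mk, AddHom.coe_mk] at h
    split_ifs at h
    · have hs := wt_step (n₀ * d) k I hI j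
      rcases coeff_tIf_mul _ _ _ h with ⟨h1, h2⟩ | ⟨h1, c', rfl, h2⟩
      · have := hv _ _ h2
        rw [if_pos (not_not.1 h1)] at hs
        push_cast at *
        linarith
      · have := hv _ _ h2
        rw [if_neg h1] at hs
        push_cast at *
        zify at hkn
        linarith
    · simp at h
  · simp only [genAct, LinearMap.coe_mk, AddHom.coe_mk] at h
    split_ifs at h
    · have hs := wt_step (n₀ * d) k I hI (j + 1)
      rw [add_sub_cancel_right] at hs
      rcases coeff_tIf_mul _ _ _ h with ⟨h1, h2⟩ | ⟨h1, c', rfl, h2⟩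
      · have := hv _ _ h2
        rw [if_neg h1] at hs
        push_cast at *
        linarith
      · have := hv _ _ h2
        rw [if_pos h1] at hs
        push_cast at *
        linarith
    · simp at h

lemma preAct_filt {n₀ d k : ℕ} [NeZero n₀] [NeZero d] (I : Finset (ZMod (n₀ * d)))
    (hI : I.card = k) (hk : 0 < k) (hkn : k < n₀ * d) (a : Preproj n₀) (q : ℤ) (v : Carrier n₀ d)
    (hv : Filt (n₀ * d) k I q v) : Filt (n₀ * d) k I q (preAct n₀ d I a v) := by
  obtain ⟨b, rfl⟩ := RingQuot.mkAlgHom_surjective ℂ (Rel n₀) a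
  have hb : preAct n₀ d I (RingQuot.mkAlgHom ℂ (Rel n₀) b) =
      FreeAlgebra.lift ℂ (genAct n₀ d I) b := by
    unfold preAct
    erw [RingQuot.liftAlgHom_mkAlgHom_apply]
  rw [hb]
  clear hb
  induction b using FreeAlgebra.induction generalizing v with
  | grade0 r =>
    intro j c h
    refine hv j c fun h0 => h ?_
    rw [AlgHom.commutes, Module.algebraMap_end_apply, Pi.smul_apply, PowerSeries.coeff_smul, h0,
      smul_zero]
  | grade1 g =>
    rw [FreeAlgebra.lift_ι_apply]
    cases g with
    | e i => exact (genAct_filt I hI hk hkn q v hv i).1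
    | x i => exact (genAct_filt I hI hk hkn q v hv i).2.1.mono (by omega)
    | y i => exact (genAct_filt I hI hk hkn q v hv i).2.2.mono (by omega)
  | mul a b ha hb => rw [map_mul]; exact ha _ (hb _ hv)
  | add a b ha hb => rw [map_add]; exact (ha _ hv).add (hb _ hv)

/-- The elements that raise degrees by at least `q`. -/
def degIdeal {n₀ d k : ℕ} [NeZero n₀] [NeZero d] (I : Finset (ZMod (n₀ * d)))
    (hI : I.card = k) (hk : 0 < k) (hkn : k < n₀ * d) (q : ℕ) : Ideal (Preproj n₀) where
  carrier := {a | ∀ (p : ℤ) (v : Carrier n₀ d), Filt (n₀ * d) k I p v →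
    Filt (n₀ * d) k I (p + q) (preAct n₀ d I a v)}
  add_mem' ha hb p v hv := by
    rw [map_add]; exact (ha p v hv).add (hb p v hv)
  zero_mem' p v hv := by
    rw [map_zero]; exact Filt.zero _ _ _ _
  smul_mem' a b hb p v hv := by
    rw [smul_eq_mul, map_mul]
    exact preAct_filt I hI hk hkn a _ _ (hb p v hv)

lemma arrowIdeal_le {n₀ d k : ℕ} [NeZero n₀] [NeZero d] (I : Finset (ZMod (n₀ * d)))
    (hI : I.card = k) (hk : 0 < k) (hkn : k < n₀ * d) :
    arrowIdeal n₀ ≤ degIdeal I hI hk hkn 1 := by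
  have : (degIdeal I hI hk hkn 1).IsTwoSided := ⟨fun {a} b ha p v hv => by
    rw [map_mul]
    exact ha p _ (preAct_filt I hI hk hkn b p v hv)⟩
  have h : TwoSidedIdeal.span
      {a | ∃ i, a = Preproj.gen n₀ (Gen.x i) ∨ a = Preproj.gen n₀ (Gen.y i)} ≤
      (degIdeal I hI hk hkn 1).toTwoSided := by
    rw [TwoSidedIdeal.span_le]
    rintro a ⟨i, rfl | rfl⟩
    · refine Ideal.mem_toTwoSided.2 fun p v hv => ?_
      rw [preAct_gen]
      exact (genAct_filt I hI hk hkn p v hv i).2.1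
    · refine Ideal.mem_toTwoSided.2 fun p v hv => ?_
      rw [preAct_gen]
      exact (genAct_filt I hI hk hkn p v hv i).2.2
  intro a ha
  exact Ideal.mem_toTwoSided.1 (h (TwoSidedIdeal.mem_asIdeal.1 ha))

lemma arrowIdeal_pow_le {n₀ d k : ℕ} [NeZero n₀] [NeZero d] (I : Finset (ZMod (n₀ * d)))
    (hI : I.card = k) (hk : 0 < k) (hkn : k < n₀ * d) (q : ℕ) :
    arrowIdeal n₀ ^ q ≤ degIdeal I hI hk hkn q := by
  induction q with
  | zero =>
    intro a _ p v hv
    rw [Nat.cast_zero, add_zero]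
    exact preAct_filt I hI hk hkn a p v hv
  | succ q ih =>
    rw [Submodule.pow_succ]
    refine Ideal.mul_le.2 fun a ha b hb p v hv => ?_
    rw [map_mul]
    have h := ih ha _ _ (arrowIdeal_le I hI hk hkn hb p v hv)
    exact h.mono (by push_cast; omega)

/-- A level of the completion that determines the coefficients at `t ^ c`. -/
def level (n₀ d c : ℕ) : ℕ := n₀ * d * c + 2 * (n₀ * d * (n₀ * d)) + 1

lemma level_mono (n₀ d : ℕ) : Monotone (level n₀ d) := fun a b h => by
  unfold level; gcongr

lemma preAct_continuous {n₀ d k : ℕ} [NeZero n₀] [NeZero d] (I : Finset (ZMod (n₀ * d)))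
    (hI : I.card = k) (hk : 0 < k) (hkn : k < n₀ * d) :
    IsContinuousAction (arrowIdeal n₀) (preAct n₀ d I) (level n₀ d) := by
  intro c q hq a ha v j
  by_contra h
  have h0 : Filt (n₀ * d) k I (-((n₀ * d : ℕ) * (n₀ * d : ℕ))) v := fun j c _ => by
    have := (abs_le.1 (abs_wt_le (n₀ * d) k I hkn.le j)).1
    have : (0 : ℤ) ≤ ((n₀ * d : ℕ) : ℤ) * c := by positivity
    linarith
  have h1 := arrowIdeal_pow_le I hI hk hkn q ha _ v h0 j c h
  have h2 := (abs_le.1 (abs_wt_le (n₀ * d) k I hkn.le j)).2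
  unfold level at hq
  zify at hq
  push_cast at *
  linarith

/-- The action of `Π_{n₀}` on `L_{[I]}`. -/
def complAct {n₀ d k : ℕ} [NeZero n₀] [NeZero d] (hk : 0 < k) (hkn : k < n₀ * d)
    (I : KSubset (n₀ * d) k) : CompletePreproj n₀ →+* Module.End ℂ⟦X⟧ (Carrier n₀ d) :=
  extAct (𝔪 := arrowIdeal n₀) (level_mono n₀ d) (preAct_continuous I.1 I.2 hk hkn)

lemma complAct_gen {n₀ d k : ℕ} [NeZero n₀] [NeZero d] (hk : 0 < k) (hkn : k < n₀ * d)
    (I : KSubset (n₀ * d) k) (g : Gen n₀) :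
    complAct hk hkn I (CompletePreproj.gen n₀ g) = genAct n₀ d I.1 g :=
  (extAct_of (𝔪 := arrowIdeal n₀) (level_mono n₀ d) (preAct_continuous I.1 I.2 hk hkn) _).trans
    (preAct_gen n₀ d I.1 g)

lemma complAct_x {n₀ d k : ℕ} [NeZero n₀] [NeZero d] (hk : 0 < k) (hkn : k < n₀ * d)
    (I : KSubset (n₀ * d) k) (v : Carrier n₀ d) (j : ZMod (n₀ * d)) :
    complAct hk hkn I (xTot n₀) v j = tIf (j ∉ I.1) * v (j - 1) := by
  rw [xTot, map_sum, LinearMap.sum_apply, Finset.sum_apply]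
  simp [complAct_gen, genAct]

lemma complAct_y {n₀ d k : ℕ} [NeZero n₀] [NeZero d] (hk : 0 < k) (hkn : k < n₀ * d)
    (I : KSubset (n₀ * d) k) (v : Carrier n₀ d) (j : ZMod (n₀ * d)) :
    complAct hk hkn I (yTot n₀) v j = tIf (j + 1 ∈ I.1) * v (j + 1) := by
  rw [yTot, map_sum, LinearMap.sum_apply, Finset.sum_apply]
  simp [complAct_gen, genAct]

lemma complAct_xy {n₀ d k : ℕ} [NeZero n₀] [NeZero d] (hk : 0 < k) (hkn : k < n₀ * d)
    (I : KSubset (n₀ * d) k) (v : Carrier n₀ d) :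
    complAct hk hkn I (xTot n₀) (complAct hk hkn I (yTot n₀) v) = (PowerSeries.X : ℂ⟦X⟧) • v := by
  funext j
  rw [complAct_x, complAct_y, sub_add_cancel, ← mul_assoc, tIf_not_mul]
  rfl

lemma complAct_x_pow {n₀ d k : ℕ} [NeZero n₀] [NeZero d] (hk : 0 < k) (hkn : k < n₀ * d)
    (I : KSubset (n₀ * d) k) (r : ℕ) (v : Carrier n₀ d) (j : ZMod (n₀ * d)) :
    complAct hk hkn I (xTot n₀ ^ r) v j =
      (∏ s ∈ Finset.range r, tIf (j - s ∉ I.1)) * v (j - r) := by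
  induction r generalizing v with
  | zero => simp
  | succ r ih =>
    rw [pow_succ, map_mul, Module.End.mul_apply, ih, complAct_x, Finset.prod_range_succ, mul_assoc]
    push_cast
    rw [sub_sub]

lemma prod_tIf {n k : ℕ} [NeZero n] (I : Finset (ZMod n)) (hI : I.card = k) (j : ZMod n) :
    ∏ s ∈ Finset.range n, tIf (j - s ∉ I) = (PowerSeries.X : ℂ⟦X⟧) ^ (n - k) := by
  have h : ∏ s ∈ Finset.range n, tIf (j - s ∉ I) = ∏ a : ZMod n, tIf (a ∉ I) := by
    refine Finset.prod_bij (fun s _ => j - s) (fun _ _ => Finset.mem_univ _) ?_ ?_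
      (fun _ _ => rfl)
    · intro s hs s' hs' h
      have h := (ZMod.natCast_eq_natCast_iff' _ _ _).1 (sub_right_injective h)
      rwa [Nat.mod_eq_of_lt (Finset.mem_range.1 hs),
        Nat.mod_eq_of_lt (Finset.mem_range.1 hs')] at h
    · intro a _
      exact ⟨(j - a).val, Finset.mem_range.2 (ZMod.val_lt _), by
        rw [ZMod.natCast_zmod_val]; ring⟩
  rw [h]
  classical
  have h2 : ∀ a : ZMod n, tIf (a ∉ I) = if a ∈ Iᶜ then PowerSeries.X else 1 := fun a => by
    by_cases ha : a ∈ I <;> simp [tIf, ha]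
  simp_rw [h2]
  rw [Finset.prod_ite_mem, Finset.univ_inter, Finset.prod_const, Finset.card_compl, hI, ZMod.card]

lemma complAct_rel {n₀ d k : ℕ} [NeZero n₀] [NeZero d] (hk : 0 < k) (hkn : k < n₀ * d)
    (I : KSubset (n₀ * d) k) :
    complAct hk hkn I (xTot n₀ ^ k) = complAct hk hkn I (yTot n₀ ^ (n₀ * d - k)) := by
  have hxy : ∀ (r : ℕ) (v : Carrier n₀ d),
      complAct hk hkn I (xTot n₀ ^ r) (complAct hk hkn I (yTot n₀ ^ r) v) =
        (PowerSeries.X : ℂ⟦X⟧) ^ r • v := by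
    intro r
    induction r with
    | zero => intro v; simp
    | succ r ih =>
      intro v
      rw [pow_succ, pow_succ', map_mul, map_mul, Module.End.mul_apply, Module.End.mul_apply,
        complAct_xy, map_smul, ih, smul_smul, ← pow_succ']
  have hinj : Function.Injective (complAct hk hkn I (xTot n₀ ^ (n₀ * d - k))) := by
    intro v w h
    funext j
    have h1 := congrFun h (j + ((n₀ * d - k : ℕ) : ZMod (n₀ * d)))
    rw [complAct_x_pow, complAct_x_pow, add_sub_cancel_right] at h1
    refine mul_left_cancel₀ (Finset.prod_ne_zero_iff.2 fun s _ => ?_) h1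
    unfold tIf
    split_ifs
    · exact one_ne_zero
    · exact PowerSeries.X_ne_zero
  refine LinearMap.ext fun v => hinj ?_
  rw [hxy, ← Module.End.mul_apply, ← map_mul, ← pow_add, Nat.sub_add_cancel hkn.le]
  funext j
  rw [complAct_x_pow, prod_tIf I.1 I.2 j, ZMod.natCast_self, sub_zero]
  rfl

/-- The action of `B_G` on `L_{[I]}`. -/
def bgAct {n₀ d k : ℕ} [NeZero n₀] [NeZero d] (hk : 0 < k) (hkn : k < n₀ * d)
    (I : KSubset (n₀ * d) k) : BG n₀ d k →+* Module.End ℂ⟦X⟧ (Carrier n₀ d) :=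
  Ideal.Quotient.lift (relIdeal n₀ d k) (complAct hk hkn I) (by
    have h : TwoSidedIdeal.span {xTot n₀ ^ k - yTot n₀ ^ (n₀ * d - k)} ≤
        TwoSidedIdeal.ker (complAct hk hkn I) := by
      rw [TwoSidedIdeal.span_le]
      rintro a rfl
      refine (TwoSidedIdeal.mem_ker _).2 ?_
      rw [map_sub, complAct_rel, sub_self]
    intro a ha
    exact (TwoSidedIdeal.mem_ker _).1 (h (TwoSidedIdeal.mem_asIdeal.1 ha)))

/-- The `B_G`-module `L_{[I]}` attached to the `k`-subset `I`, for `0 < k < n₀ d`. -/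
def L {n₀ d k : ℕ} (_hk : 0 < k) (_hkn : k < n₀ * d) (_I : KSubset (n₀ * d) k) : Type :=
  Carrier n₀ d

section Module

variable {n₀ d k : ℕ} [NeZero n₀] [NeZero d] (hk : 0 < k) (hkn : k < n₀ * d)
  (I : KSubset (n₀ * d) k)

instance : AddCommGroup (L hk hkn I) := inferInstanceAs (AddCommGroup (Carrier n₀ d))

instance : Module ℂ⟦X⟧ (L hk hkn I) := inferInstanceAs (Module ℂ⟦X⟧ (Carrier n₀ d))

instance : Module (BG n₀ d k) (L hk hkn I) :=
  letI : Module (Module.End ℂ⟦X⟧ (Carrier n₀ d)) (L hk hkn I) :=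
    inferInstanceAs (Module (Module.End ℂ⟦X⟧ (Carrier n₀ d)) (Carrier n₀ d))
  Module.compHom (L hk hkn I) (bgAct hk hkn I)

/-- The vertices and arrows of `B_G` act on `L_{[I]}` by the formulas of `genAct`. -/
lemma gen_smul (g : Gen n₀) (v : L hk hkn I) :
    BG.gen n₀ d k g • v = (genAct n₀ d I.1 g v : Carrier n₀ d) :=
  LinearMap.congr_fun (complAct_gen hk hkn I g) v

/-- The basis vector `𝟏_i^l` of `L_{[I]}`. -/
def one (i l : ℤ) : L hk hkn I := Pi.single ((i + l * n₀ : ℤ) : ZMod (n₀ * d)) (1 : ℂ⟦X⟧)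

lemma e_smul_one (i j l : ℤ) :
    BG.gen n₀ d k (.e i) • one hk hkn I j l =
      haveI := Classical.dec ((j : ZMod n₀) = i)
      if (j : ZMod n₀) = i then one hk hkn I j l else 0 := by
  rw [gen_smul]
  funext a
  by_cases h : a = ((j + l * n₀ : ℤ) : ZMod (n₀ * d))
  · subst h
    by_cases hj : (j : ZMod n₀) = i
    · simp [genAct, one, hj]
    · simp [genAct, one, hj]
      rfl
  · have h0 : one hk hkn I j l a = 0 := Pi.single_eq_of_ne h _
    by_cases hj : (j : ZMod n₀) = i
    · simp [genAct, h0, hj]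
    · simp [genAct, h0, hj]
      rfl

lemma x_smul_one (i l : ℤ) :
    BG.gen n₀ d k (.x i) • one hk hkn I (i - 1) l =
      tIf (((i + l * n₀ : ℤ) : ZMod (n₀ * d)) ∉ I.1) • one hk hkn I i l := by
  rw [gen_smul]
  funext a
  by_cases h : a = ((i + l * n₀ : ℤ) : ZMod (n₀ * d))
  · subst h
    have h1 : ((i + l * n₀ : ℤ) : ZMod (n₀ * d)) - 1 = ((i - 1 + l * n₀ : ℤ) : ZMod (n₀ * d)) := by
      push_cast; ring
    have h2 : one hk hkn I (i - 1) l (((i + l * n₀ : ℤ) : ZMod (n₀ * d)) - 1) = 1 := by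
      rw [h1]; exact Pi.single_eq_same _ _
    have h3 : one hk hkn I i l ((i + l * n₀ : ℤ) : ZMod (n₀ * d)) = 1 := Pi.single_eq_same _ _
    change (if _ then _ else _) = _ * one hk hkn I i l _
    rw [h2, h3]
    simp
  · have h2 : one hk hkn I (i - 1) l (a - 1) = 0 := Pi.single_eq_of_ne (fun h' => h (by
      rw [← sub_add_cancel a 1, h']; push_cast; ring)) _
    have h3 : one hk hkn I i l a = 0 := Pi.single_eq_of_ne h _
    change (if _ then _ else _) = _ * one hk hkn I i l _
    rw [h2, h3]
    simp

lemma y_smul_one (i l : ℤ) :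
    BG.gen n₀ d k (.y i) • one hk hkn I i l =
      tIf (((i + l * n₀ : ℤ) : ZMod (n₀ * d)) ∈ I.1) • one hk hkn I (i - 1) l := by
  rw [gen_smul]
  funext a
  by_cases h : a = ((i - 1 + l * n₀ : ℤ) : ZMod (n₀ * d))
  · subst h
    have h1 : ((i - 1 + l * n₀ : ℤ) : ZMod (n₀ * d)) + 1 = ((i + l * n₀ : ℤ) : ZMod (n₀ * d)) := by
      push_cast; ring
    have h2 : one hk hkn I i l (((i + l * n₀ : ℤ) : ZMod (n₀ * d))) = 1 := Pi.single_eq_same _ _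
    have h3 : one hk hkn I (i - 1) l ((i - 1 + l * n₀ : ℤ) : ZMod (n₀ * d)) = 1 :=
      Pi.single_eq_same _ _
    change (if _ then _ else _) = _ * one hk hkn I (i - 1) l _
    rw [h1, h2, h3]
    simp
  · have h2 : one hk hkn I i l (a + 1) = 0 := Pi.single_eq_of_ne (fun h' => h (by
      rw [← add_sub_cancel_right a 1, h']; push_cast; ring)) _
    have h3 : one hk hkn I (i - 1) l a = 0 := Pi.single_eq_of_ne h _
    change (if _ then _ else _) = _ * one hk hkn I (i - 1) l _
    rw [h2, h3]
    simp

end Module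

/-! ## Strand diagrams in the disk

The disk is the closed unit disk in `ℂ`. A family of `N` curves is a map `γ : ZMod N → ℝ → ℂ`, of
which only the values at parameters in `[0, 1]` matter. -/

/-- The `j`-th of `N` marked points on the unit circle. They are numbered clockwise, and the
boundary arc between the `N`-th and the first marked point contains the point `1`. -/
def mark (N : ℕ) (j : ZMod N) : ℂ :=
  Complex.exp (-(2 * Real.pi * Complex.I * (((j.val : ℂ) - 1 / 2) / N)))

/-- The velocity vector of the `i`-th curve at time `s`. -/
def vel {N : ℕ} (γ : ZMod N → ℝ → ℂ) (i : ZMod N) (s : ℝ) : ℂ :=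
  derivWithin (γ i) (Set.Icc 0 1) s

/-- The pairs (curve, time) `p` and `q` are different and the curves meet there. Points on the
boundary of the disk and crossings of a curve with itself are included. -/
def IsCrossing {N : ℕ} (γ : ZMod N → ℝ → ℂ) (p q : ZMod N × ℝ) : Prop :=
  p ≠ q ∧ p.2 ∈ Set.Icc (0 : ℝ) 1 ∧ q.2 ∈ Set.Icc (0 : ℝ) 1 ∧ γ p.1 p.2 = γ q.1 q.2

/-- The determinant of the velocities at `p` and `q`: at a crossing it is positive if the second
curve comes from the right of the first, negative if it comes from the left, and nonzero if
the crossing is transverse. -/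
def crossDet {N : ℕ} (γ : ZMod N → ℝ → ℂ) (p q : ZMod N × ℝ) : ℝ :=
  ((starRingEnd ℂ) (vel γ p.1 p.2) * vel γ q.1 q.2).im

/-- The number of turns, counted clockwise, of the `i`-th curve around the origin between the
times `a` and `b`. -/
def turns {N : ℕ} (γ : ZMod N → ℝ → ℂ) (i : ZMod N) (a b : ℝ) : ℝ :=
  -(1 / (2 * Real.pi)) * ∫ u in a..b, (vel γ i u / γ i u).im

/-- The curves `i` and `j` are different and meet in two points `A`, `B`, both being oriented from
`A` to `B`; they are at `A` at the times `s₁`, `t₁` and at `B` at the times `s₂`, `t₂`. The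
winding number around the origin of the loop formed by the two arcs is
`turns γ i s₁ s₂ - turns γ j t₁ t₂`. -/
def IsParallelLens {N : ℕ} (γ : ZMod N → ℝ → ℂ) (i j : ZMod N) (s₁ s₂ t₁ t₂ : ℝ) : Prop :=
  i ≠ j ∧ 0 ≤ s₁ ∧ s₁ < s₂ ∧ s₂ ≤ 1 ∧ 0 ≤ t₁ ∧ t₁ < t₂ ∧ t₂ ≤ 1 ∧
    γ i s₁ = γ j t₁ ∧ γ i s₂ = γ j t₂

/-- The curve `i` is at the same point at the times `s₁ < s₂`. -/
def IsLoop {N : ℕ} (γ : ZMod N → ℝ → ℂ) (i : ZMod N) (s₁ s₂ : ℝ) : Prop :=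
  0 ≤ s₁ ∧ s₁ < s₂ ∧ s₂ ≤ 1 ∧ γ i s₁ = γ i s₂

/-- Weak orbifold diagrams on a disk with `n₀` marked points, with the orbifold point at the
origin. -/
structure WeakOrbifoldDiagram (n₀ : ℕ) where
  /-- The strands. -/
  strand : ZMod n₀ → ℝ → ℂ
  /-- The type of the diagram. -/
  perm : Equiv.Perm (ZMod n₀)
  smooth : ∀ i, ContDiffOn ℝ ∞ (strand i) (Set.Icc 0 1)
  regular : ∀ i, ∀ s ∈ Set.Icc (0 : ℝ) 1, vel strand i s ≠ 0
  source : ∀ i, strand i 0 = mark n₀ i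
  target : ∀ i, strand i 1 = mark n₀ (perm i)
  inside : ∀ i, ∀ s ∈ Set.Ioo (0 : ℝ) 1, ‖strand i s‖ < 1
  avoids : ∀ i, ∀ s ∈ Set.Icc (0 : ℝ) 1, strand i s ≠ 0
  finite : {p : (ZMod n₀ × ℝ) × (ZMod n₀ × ℝ) | IsCrossing strand p.1 p.2}.Finite
  double : ∀ p q q', IsCrossing strand p q → IsCrossing strand p q' → q = q'
  transverse : ∀ p q, IsCrossing strand p q → crossDet strand p q ≠ 0
  /-- Along a strand, crossings come alternately from the left and from the right. -/
  alternating : ∀ i s₁ s₂ q₁ q₂, s₁ < s₂ → IsCrossing strand (i, s₁) q₁ →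
    IsCrossing strand (i, s₂) q₂ → (∀ s ∈ Set.Ioo s₁ s₂, ∀ q, ¬ IsCrossing strand (i, s) q) →
    crossDet strand (i, s₁) q₁ * crossDet strand (i, s₂) q₂ < 0
  lens : ∀ i j s₁ s₂ t₁ t₂, IsParallelLens strand i j s₁ s₂ t₁ t₂ →
    turns strand i s₁ s₂ - turns strand j t₁ t₂ ≠ 0
  /-- A loop has nonzero winding number or is simple and not met by another strand. -/
  loop : ∀ i s₁ s₂, IsLoop strand i s₁ s₂ → turns strand i s₁ s₂ ≠ 0 ∨
    (Set.InjOn (strand i) (Set.Ico s₁ s₂) ∧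
      ∀ s ∈ Set.Icc s₁ s₂, ∀ j, j ≠ i → ∀ t ∈ Set.Icc (0 : ℝ) 1, strand j t ≠ strand i s)

/-- Orbifold diagrams of order `d > 1`: all the winding numbers above are less than `d` in absolute
value. -/
structure OrbifoldDiagram (n₀ d : ℕ) extends WeakOrbifoldDiagram n₀ where
  one_lt : 1 < d
  loop_lt : ∀ i s₁ s₂, IsLoop strand i s₁ s₂ → |turns strand i s₁ s₂| < d
  lens_lt : ∀ i j s₁ s₂ t₁ t₂, IsParallelLens strand i j s₁ s₂ t₁ t₂ →
    |turns strand i s₁ s₂ - turns strand j t₁ t₂| < d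

/-- The orbifold diagram is Grassmannian of type `(k, n₀ d)`. -/
def OrbifoldDiagram.IsGrassmannian {n₀ d : ℕ} (O : OrbifoldDiagram n₀ d) (k : ℕ) : Prop :=
  O.perm = 1 ∧ ∃ w : ℕ, 0 < w ∧ w < d ∧ k = n₀ * w ∧
    ∀ i, turns O.strand i 0 1 = w ∨ turns O.strand i 0 1 = (w : ℝ) - d

/-- The strands of the cover `sym_d(O)`, which consists of `d` copies of `O` glued along a curve
from the orbifold point to the boundary arc between `n₀` and `1`. In coordinates the projection of
the cover to the disk is `z ↦ z ^ d`, and the strand that starts at the marked point `i` of the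
`n₀ d` marked points is the lift of the strand that starts at `i` modulo `n₀`. -/
def OrbifoldDiagram.sym {n₀ d : ℕ} (O : OrbifoldDiagram n₀ d) (i : ZMod (n₀ * d)) (s : ℝ) : ℂ :=
  mark (n₀ * d) i * Complex.exp ((1 / d) *
    ∫ u in (0 : ℝ)..s, vel O.strand (red n₀ d i) u / O.strand (red n₀ d i) u)

/-- The complement of the strands in the disk. -/
def complStrands {N : ℕ} (γ : ZMod N → ℝ → ℂ) : Set ℂ :=
  Metric.closedBall 0 1 \ ⋃ i, γ i '' Set.Icc 0 1

/-- The region of the diagram that contains `z`. -/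
def region {N : ℕ} (γ : ZMod N → ℝ → ℂ) (z : ℂ) : Set ℂ :=
  connectedComponentIn (complStrands γ) z

/-- The region `R` is adjacent, on its left side, to the `i`-th strand at time `s`. -/
def AdjLeft {N : ℕ} (γ : ZMod N → ℝ → ℂ) (R : Set ℂ) (i : ZMod N) (s : ℝ) : Prop :=
  ∀ᶠ ε : ℝ in 𝓝[>] 0, γ i s + ε * (Complex.I * vel γ i s) ∈ R

/-- The region `R` is adjacent, on its right side, to the `i`-th strand at time `s`. -/
def AdjRight {N : ℕ} (γ : ZMod N → ℝ → ℂ) (R : Set ℂ) (i : ZMod N) (s : ℝ) : Prop :=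
  ∀ᶠ ε : ℝ in 𝓝[>] 0, γ i s - ε * (Complex.I * vel γ i s) ∈ R

/-- The adjacent strands give the boundary of the region a cyclic orientation: the region is
not a boundary region, and it lies to the left of all strands adjacent to it or to the right of all
of them. -/
def IsCyclical {N : ℕ} (γ : ZMod N → ℝ → ℂ) (R : Set ℂ) : Prop :=
  Disjoint R (Metric.sphere 0 1) ∧
    ((∀ i, ∀ s ∈ Set.Ioo (0 : ℝ) 1, ¬ AdjRight γ R i s) ∨
      (∀ i, ∀ s ∈ Set.Ioo (0 : ℝ) 1, ¬ AdjLeft γ R i s))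

/-- The point `z` is in the piece of the disk to the left of the `i`-th strand, that is, in the
component of the complement of this strand that is adjacent to its initial part on the left. -/
def IsLeftOf {N : ℕ} (γ : ZMod N → ℝ → ℂ) (i : ZMod N) (z : ℂ) : Prop :=
  ∀ᶠ s in 𝓝[>] (0 : ℝ),
    AdjLeft γ (connectedComponentIn (Metric.closedBall 0 1 \ γ i '' Set.Icc 0 1) z) i s

/-- The `k`-subset `I` is the label of an alternating (that is, not cyclical) region of the
diagram: it consists of those `i` for which the region lies to the left of the `i`-th strand. -/
def IsLabel {N k : ℕ} (γ : ZMod N → ℝ → ℂ) (I : KSubset N k) : Prop :=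
  ∃ z ∈ complStrands γ, ¬ IsCyclical γ (region γ z) ∧ ∀ i, i ∈ I.1 ↔ IsLeftOf γ i z

/-- The set `𝓘_O` of classes `[I]` of the labels `I` of the alternating regions of `sym_d(O)`. For
a diagram of type `(k, n₀ d)` the labels are `k`-subsets. -/
def OrbifoldDiagram.labelClasses {n₀ d : ℕ} (O : OrbifoldDiagram n₀ d) (k : ℕ) :
    Set (SubsetClass n₀ d k) :=
  {c | ∃ I : KSubset (n₀ * d) k, IsLabel O.sym I ∧ cls n₀ I = c}

/-- The module `T_O`, the direct sum of the `L_{[I]}` over the classes `[I]` in `𝓘_O`. For every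
class a representative is chosen. -/
abbrev OrbifoldDiagram.T {n₀ d k : ℕ} [NeZero n₀] [NeZero d] (hk : 0 < k) (hkn : k < n₀ * d)
    (O : OrbifoldDiagram n₀ d) : Type :=
  DirectSum (O.labelClasses k) fun c => L hk hkn (Quotient.out c.1)

end OrbifoldDiagrams

end

/-!
The modules `L_{[I]}` are free over `ℂ⟦t⟧`, where `t` acts as `x y`, and every `B_G`-linear map
`L_{[I]} → L_{[J]}` is `ℂ⟦t⟧`-linear, hence given by a matrix `M` indexed by `ℤ / n₀ d`. Its entry
`M b a` vanishes unless `b - a` is a multiple of `n₀`, and commutation with `x` relates the entries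
along each diagonal `b - a = m` (`tIf_mul_mat`). If `I + m = J`, the diagonal is constant. If not,
some entry on it is divisible by `t`. Going along a diagonal for `f : L_{[I]} → L_{[J]}` and
simultaneously back along one for `g : L_{[J]} → L_{[K]}`, where `K` is a translate of `I`, the
product of the two entries stays the same; so it is divisible by `t` everywhere as soon as
`I + m ≠ J` (`constantCoeff_mat_mul_mat`).

If `L_{[I]}` and `L_{[J]}` are isomorphic, a diagonal entry of the identity matrix is a sum of such
products, so one of them is not divisible by `t` and `J` is a translate of `I`. Conversely, a
translation of `I` to `J` by a multiple of `n₀` gives an isomorphism (`shift`).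

A module `L_{[I]}` need not be indecomposable: the stabilizer of `I` among the multiples of `n₀`
acts on it, and `L_{[I]}` is the direct sum of the parts that belong to the characters of the
stabilizer. For an arbitrary finite family of different classes, these parts, taken for all members
of the family, are indecomposable and pairwise non-isomorphic, and in particular `T_O` is basic.
Indeed, on the endomorphism ring of the sum, the residues modulo `t` of the entries on the diagonals
that belong to elements of the stabilizers, combined by the characters, are ring homomorphisms to
`ℂ` (`charHom`), which take the values `0` and `1` on the idempotents of the characters
(`charHom_charProj`). An idempotent endomorphism killed by all of them is zero
(`eq_zero_of_charHom_eq_zero`): the diagonal of its matrix vanishes modulo `t`, so its trace, which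
is its rank, vanishes modulo `t`. Such ring homomorphisms show that the idempotents of the
characters are primitive and that their ranges are pairwise non-isomorphic
(`isBasic_of_characters`).
-/

noncomputable section

namespace OrbifoldDiagrams

/-! ### A criterion for a module to be basic -/

section Criterion

variable {R M : Type*} [Ring R] [AddCommGroup M] [Module R M]

lemma isInternal_range_of_completeOrthogonalIdempotents {ι : Type*} [Fintype ι] [DecidableEq ι]
    {e : ι → Module.End R M} (he : CompleteOrthogonalIdempotents e) :
    DirectSum.IsInternal fun i => LinearMap.range (e i) := by
  have hfix : ∀ i, ∀ v ∈ LinearMap.range (e i), ∀ j, e j v = if j = i then v else 0 := by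
    rintro i _ ⟨w, rfl⟩ j
    rw [← Module.End.mul_apply, he.mul_eq]
    split_ifs with h
    · rw [h]
    · rfl
  refine DirectSum.isInternal_submodule_of_iSupIndep_of_iSup_eq_top ?_ ?_
  · rw [iSupIndep_def]
    refine fun i => Submodule.disjoint_def.2 fun v hv hv' => ?_
    have hker : ⨆ j, ⨆ (_ : j ≠ i), LinearMap.range (e j) ≤ LinearMap.ker (e i) :=
      iSup₂_le fun j hj w hw => by rw [LinearMap.mem_ker, hfix j w hw, if_neg hj.symm]
    have h := hfix i v hv i
    rw [if_pos rfl] at h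
    rw [← h]
    exact hker hv'
  · refine eq_top_iff.2 fun v _ => ?_
    have hv : v = ∑ i, e i v := by
      rw [← LinearMap.sum_apply, he.complete, Module.End.one_apply]
    rw [hv]
    exact Submodule.sum_mem _ fun i _ =>
      Submodule.mem_iSup_of_mem (p := fun i => LinearMap.range (e i)) i ⟨v, rfl⟩

/-- The range of an idempotent `e ≠ 0` is indecomposable if `e` is primitive. -/
lemma isIndecomposable_range {e : Module.End R M} (he : IsIdempotentElem e) (h0 : e ≠ 0)
    (hprim : ∀ p : Module.End R M, IsIdempotentElem p → e * p = p → p * e = p → p = 0 ∨ p = e) :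
    IsIndecomposable R (LinearMap.range e) := by
  have hfix : ∀ v : LinearMap.range e, e v = v := by
    rintro ⟨_, w, rfl⟩
    rw [← Module.End.mul_apply, he.eq]
  refine ⟨?_, fun P Q h => ?_⟩
  · obtain ⟨v, hv⟩ : ∃ v, e v ≠ 0 := by
      by_contra! hc
      exact h0 (LinearMap.ext hc)
    exact ⟨⟨⟨e v, v, rfl⟩, 0, fun hc => hv (congrArg Subtype.val hc)⟩⟩
  · have hr : ∀ v, e.rangeRestrict (e v) = e.rangeRestrict v := fun v =>
      Subtype.ext (by
        change e (e v) = e v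
        rw [← Module.End.mul_apply, he.eq])
    have hr' : ∀ v : LinearMap.range e, e.rangeRestrict v = v := fun v => Subtype.ext (hfix v)
    rcases hprim ((LinearMap.range e).subtype ∘ₗ P.projection Q h ∘ₗ e.rangeRestrict)
      (LinearMap.ext fun v => by
        change ((P.projection Q h (e.rangeRestrict (P.projection Q h (e.rangeRestrict v)
          : LinearMap.range e)) : LinearMap.range e) : M) = _
        rw [hr', Submodule.projection_apply_of_mem_left h (Submodule.projection_apply_mem h _)]
        rfl)
      (LinearMap.ext fun v => hfix _)
      (LinearMap.ext fun v => by
        change ((P.projection Q h (e.rangeRestrict (e v)) : LinearMap.range e) : M) = _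
        rw [hr]
        rfl) with hp | hp
    · left
      refine (Submodule.eq_bot_iff _).2 fun v hv => Subtype.ext ?_
      have h1 := LinearMap.congr_fun hp (v : M)
      change ((P.projection Q h (e.rangeRestrict v) : LinearMap.range e) : M) = _ at h1
      rw [hr', Submodule.projection_apply_of_mem_left h hv] at h1
      exact h1
    · right
      refine (Submodule.eq_bot_iff _).2 fun v hv => Subtype.ext ?_
      have h1 := LinearMap.congr_fun hp (v : M)
      change ((P.projection Q h (e.rangeRestrict v) : LinearMap.range e) : M) = _ at h1
      rw [hr', hfix, (Submodule.projection_apply_eq_zero_iff h).2 hv] at h1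
      exact h1.symm

/-- The criterion says that, up to an ideal without nonzero idempotents, the endomorphism ring is a
finite power of the field `K`, and that the idempotents of this power lift. -/
theorem isBasic_of_characters {K : Type*} [Field K] {ι : Type*} [Fintype ι] [DecidableEq ι]
    {e : ι → Module.End R M} (he : CompleteOrthogonalIdempotents e)
    (Φ : ι → Module.End R M →+* K) (hΦ : ∀ i j, Φ i (e j) = if i = j then 1 else 0)
    (hker : ∀ p : Module.End R M, IsIdempotentElem p → (∀ i, Φ i p = 0) → p = 0) :
    IsBasic R M := by
  have hne : ∀ i, e i ≠ 0 := fun i h => by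
    have := hΦ i i
    rw [h, map_zero, if_pos rfl] at this
    exact zero_ne_one this
  have hprim : ∀ i, ∀ p : Module.End R M, IsIdempotentElem p → e i * p = p → p * e i = p →
      p = 0 ∨ p = e i := by
    intro i p hp h1 h2
    have hoff : ∀ j, j ≠ i → Φ j p = 0 := fun j hj => by
      rw [← h1, map_mul, hΦ, if_neg hj, zero_mul]
    rcases IsIdempotentElem.iff_eq_zero_or_one.1 (hp.map (Φ i)) with h | h
    · refine Or.inl (hker p hp fun j => ?_)
      by_cases hj : j = i
      · rw [hj, h]
      · exact hoff j hj
    · refine Or.inr (sub_eq_zero.1 (hker (e i - p) ?_ fun j => ?_)).symm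
      · have h3 := (he.idem i).eq
        have h4 := hp.eq
        change (e i - p) * (e i - p) = e i - p
        rw [sub_mul, mul_sub, mul_sub, h1, h2, h3, h4, sub_self, sub_zero]
      · rw [map_sub, hΦ]
        by_cases hj : j = i
        · rw [if_pos hj, hj, h, sub_self]
        · rw [if_neg hj, hoff j hj, sub_self]
  have hiso : ∀ i j, i ≠ j → IsEmpty (LinearMap.range (e i) ≃ₗ[R] LinearMap.range (e j)) := by
    refine fun i j hij => ⟨fun u => ?_⟩
    -- An isomorphism and its inverse give `a`, `b` with `b * a = e i` and `e j * a = a`.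
    let a : Module.End R M :=
      (LinearMap.range (e j)).subtype ∘ₗ u.toLinearMap ∘ₗ (e i).rangeRestrict
    let b : Module.End R M :=
      (LinearMap.range (e i)).subtype ∘ₗ u.symm.toLinearMap ∘ₗ (e j).rangeRestrict
    have hfix : ∀ v : LinearMap.range (e j), (e j).rangeRestrict v = v := by
      rintro ⟨_, w, rfl⟩
      refine Subtype.ext ?_
      change e j (e j w) = e j w
      rw [← Module.End.mul_apply, (he.idem j).eq]
    have hba : b * a = e i := LinearMap.ext fun v => by
      change ((u.symm ((e j).rangeRestrict (u ((e i).rangeRestrict v) : LinearMap.range (e j))) :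
        LinearMap.range (e i)) : M) = _
      rw [hfix, LinearEquiv.symm_apply_apply]
      rfl
    have hja : e j * a = a := LinearMap.ext fun v => congrArg Subtype.val (hfix _)
    have h1 := hΦ i i
    rw [← hba, ← hja, map_mul, map_mul, hΦ, if_neg hij, zero_mul, mul_zero, if_pos rfl] at h1
    exact zero_ne_one h1
  let s := Fintype.equivFin ι
  refine ⟨Fintype.card ι, fun r => LinearMap.range (e (s.symm r)),
    isInternal_range_of_completeOrthogonalIdempotents
      ((CompleteOrthogonalIdempotents.equiv s.symm).2 he),
    fun r => isIndecomposable_range (he.idem _) (hne _) (hprim _), fun r r' h =>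
      hiso _ _ (s.symm.injective.ne h)⟩

lemma isBasic_of_linearEquiv_of_characters {K M' : Type*} [Field K] [AddCommGroup M']
    [Module R M'] (u : M ≃ₗ[R] M') {ι : Type*} [Fintype ι] [DecidableEq ι]
    {e : ι → Module.End R M'} (he : CompleteOrthogonalIdempotents e)
    (Φ : ι → Module.End R M' →+* K) (hΦ : ∀ i j, Φ i (e j) = if i = j then 1 else 0)
    (hker : ∀ p : Module.End R M', IsIdempotentElem p → (∀ i, Φ i p = 0) → p = 0) :
    IsBasic R M := by
  let φ := u.conjRingEquiv
  refine isBasic_of_characters (he.map φ.symm.toRingHom) (fun i => (Φ i).comp φ.toRingHom)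
    (fun i j => ?_) fun p hp h => ?_
  · simp [hΦ]
  · have := hker (φ p) (hp.map φ) h
    simpa using this

end Criterion

/-! ### Homomorphisms between the modules `L_{[I]}` as matrices -/

section Matrices

variable {n₀ d k : ℕ} [NeZero n₀] [NeZero d] {hk : 0 < k} {hkn : k < n₀ * d}
  {I J K : KSubset (n₀ * d) k}

instance : SMulCommClass (BG n₀ d k) ℂ⟦X⟧ (L hk hkn I) :=
  ⟨fun a φ v => map_smul (bgAct hk hkn I a) φ (v : Carrier n₀ d)⟩

lemma xTot_smul_apply (v : L hk hkn I) (j : ZMod (n₀ * d)) :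
    (BG.mk n₀ d k (xTot n₀) • v) j = tIf (j ∉ I.1) * v (j - 1) :=
  complAct_x hk hkn I v j

lemma xTot_mul_yTot_smul (v : L hk hkn I) :
    BG.mk n₀ d k (xTot n₀ * yTot n₀) • v = (PowerSeries.X : ℂ⟦X⟧) • v := by
  rw [map_mul, mul_smul]
  exact complAct_xy hk hkn I v

lemma algebraMap_smul (c : ℂ) (v : L hk hkn I) :
    BG.mk n₀ d k (algebraMap ℂ (CompletePreproj n₀) c) • v = PowerSeries.C c • v := by
  have h : complAct hk hkn I (algebraMap ℂ (CompletePreproj n₀) c) =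
      algebraMap ℂ (Module.End ℂ⟦X⟧ (Carrier n₀ d)) c :=
    (extAct_of (𝔪 := arrowIdeal n₀) (level_mono n₀ d) (preAct_continuous I.1 I.2 hk hkn)
      (algebraMap ℂ (Preproj n₀) c)).trans (AlgHom.commutes _ c)
  exact (LinearMap.congr_fun h v).trans (funext fun j => PowerSeries.smul_eq_C_mul _ _)

/-- Multiplication by `t` is the action of `x y`, and `B_G`-linear maps are automatically
`t`-adically continuous. -/
lemma map_powerSeries_smul (f : L hk hkn I →ₗ[BG n₀ d k] L hk hkn J) (φ : ℂ⟦X⟧)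
    (v : L hk hkn I) : f (φ • v) = φ • f v := by
  have hX : ∀ w : L hk hkn I, f ((PowerSeries.X : ℂ⟦X⟧) • w) = (PowerSeries.X : ℂ⟦X⟧) • f w :=
    fun w => by rw [← xTot_mul_yTot_smul, map_smul, xTot_mul_yTot_smul]
  have hC : ∀ (c : ℂ) (w : L hk hkn I), f (PowerSeries.C c • w) = PowerSeries.C c • f w :=
    fun c w => by rw [← algebraMap_smul, map_smul, algebraMap_smul]
  have key : ∀ (c : ℕ) (φ : ℂ⟦X⟧) (j : ZMod (n₀ * d)),
      PowerSeries.coeff c (f (φ • v) j) = PowerSeries.coeff c (φ * f v j) := by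
    intro c
    induction c with
    | zero =>
      intro φ j
      rw [PowerSeries.eq_X_mul_shift_add_const φ, add_smul, mul_smul, map_add, hX, hC]
      change PowerSeries.coeff 0 (PowerSeries.X * _ + PowerSeries.C _ * f v j) = _
      simp [add_mul]
    | succ c ih =>
      intro φ j
      rw [PowerSeries.eq_X_mul_shift_add_const φ, add_smul, mul_smul, map_add, hX, hC]
      change PowerSeries.coeff (c + 1) (PowerSeries.X * f (_ • v) j + PowerSeries.C _ * f v j) = _
      rw [add_mul, map_add, map_add, PowerSeries.coeff_succ_X_mul, ih, mul_assoc,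
        PowerSeries.coeff_succ_X_mul]
  funext j
  ext c
  exact key c φ j

variable (hk hkn I) in
/-- The basis vector of `L_{[I]}` of index `a`. -/
def basisVec (a : ZMod (n₀ * d)) : L hk hkn I := Pi.single a (1 : ℂ⟦X⟧)

lemma sum_smul_basisVec (v : L hk hkn I) : ∑ a, v a • basisVec hk hkn I a = v := by
  change ∑ a, (v a • Pi.single a (1 : ℂ⟦X⟧) : Carrier n₀ d) = v
  simp_rw [← Pi.single_smul, smul_eq_mul, mul_one]
  exact Finset.univ_sum_single v

/-- The matrix of a homomorphism with respect to the bases of `L_{[I]}` and `L_{[J]}`. -/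
def mat (f : L hk hkn I →ₗ[BG n₀ d k] L hk hkn J) :
    Matrix (ZMod (n₀ * d)) (ZMod (n₀ * d)) ℂ⟦X⟧ :=
  Matrix.of fun b a => f (basisVec hk hkn I a) b

lemma map_apply_eq_sum (f : L hk hkn I →ₗ[BG n₀ d k] L hk hkn J) (v : L hk hkn I)
    (b : ZMod (n₀ * d)) : f v b = ∑ a, mat f b a * v a := by
  conv_lhs => rw [← sum_smul_basisVec v, map_sum]
  simp_rw [map_powerSeries_smul]
  refine (Finset.sum_apply b Finset.univ
    (fun a => (v a • f (basisVec hk hkn I a) : Carrier n₀ d))).trans ?_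
  exact Finset.sum_congr rfl fun a _ => mul_comm _ _

lemma mat_comp (g : L hk hkn J →ₗ[BG n₀ d k] L hk hkn K)
    (f : L hk hkn I →ₗ[BG n₀ d k] L hk hkn J) : mat (g ∘ₗ f) = mat g * mat f := by
  ext1 c a
  exact map_apply_eq_sum g (f (basisVec hk hkn I a)) c

lemma mat_id : mat (LinearMap.id : L hk hkn I →ₗ[BG n₀ d k] L hk hkn I) = 1 := by
  ext1 b a
  rw [Matrix.one_apply]
  exact Pi.single_apply a (1 : ℂ⟦X⟧) b

lemma mat_sum {ι : Type*} (s : Finset ι) (f : ι → (L hk hkn I →ₗ[BG n₀ d k] L hk hkn J)) :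
    mat (∑ i ∈ s, f i) = ∑ i ∈ s, mat (f i) := by
  let φ : (L hk hkn I →ₗ[BG n₀ d k] L hk hkn J) →+
      Matrix (ZMod (n₀ * d)) (ZMod (n₀ * d)) ℂ⟦X⟧ :=
    { toFun := mat
      map_zero' := rfl
      map_add' := fun _ _ => rfl }
  exact map_sum φ f s

/-- Homomorphisms commute with the vertex idempotents. -/
lemma mat_eq_zero_of_red_ne (f : L hk hkn I →ₗ[BG n₀ d k] L hk hkn J) {a b : ZMod (n₀ * d)}
    (h : red n₀ d b ≠ red n₀ d a) : mat f b a = 0 := by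
  have h1 : BG.gen n₀ d k (.e (red n₀ d a)) • basisVec hk hkn I a = basisVec hk hkn I a := by
    rw [gen_smul]
    funext j
    change (if red n₀ d j = red n₀ d a then basisVec hk hkn I a j else 0) = _
    split_ifs with hj
    · rfl
    · have h0 : basisVec hk hkn I a j = 0 :=
        Pi.single_eq_of_ne (fun h' => hj (congrArg (red n₀ d) h')) _
      rw [h0]
  have h2 := map_smul f (BG.gen n₀ d k (.e (red n₀ d a))) (basisVec hk hkn I a)
  rw [h1, gen_smul] at h2
  exact (congrFun h2 b).trans (if_neg h)

/-- Homomorphisms commute with `x`. -/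
lemma tIf_mul_mat (f : L hk hkn I →ₗ[BG n₀ d k] L hk hkn J) (a b : ZMod (n₀ * d)) :
    tIf (a ∉ I.1) * mat f b a = tIf (b ∉ J.1) * mat f (b - 1) (a - 1) := by
  have h1 : BG.mk n₀ d k (xTot n₀) • basisVec hk hkn I (a - 1) =
      tIf (a ∉ I.1) • basisVec hk hkn I a := by
    funext j
    rw [xTot_smul_apply]
    change _ = tIf (a ∉ I.1) * basisVec hk hkn I a j
    by_cases hj : j = a
    · have h2 : basisVec hk hkn I (a - 1) (a - 1) = 1 := Pi.single_eq_same _ _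
      have h3 : basisVec hk hkn I a a = 1 := Pi.single_eq_same _ _
      rw [hj, h2, h3]
    · have h2 : basisVec hk hkn I (a - 1) (j - 1) = 0 :=
        Pi.single_eq_of_ne (fun h' => hj (sub_left_injective h')) _
      have h3 : basisVec hk hkn I a j = 0 := Pi.single_eq_of_ne hj _
      rw [h2, h3, mul_zero, mul_zero]
  have h2 := map_smul f (BG.mk n₀ d k (xTot n₀)) (basisVec hk hkn I (a - 1))
  rw [h1, map_powerSeries_smul] at h2
  exact (congrFun h2 b).trans (xTot_smul_apply _ b)

end Matrices

/-! ### Translations of `k`-subsets by multiples of `n₀` -/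

section Translations

variable {n₀ d k : ℕ} {I J K : KSubset (n₀ * d) k}

/-- Translation by the multiple `m` of `n₀` takes `I` to `J`. -/
structure Translates (m : ZMod (n₀ * d)) (I J : KSubset (n₀ * d) k) : Prop where
  red_eq_zero : red n₀ d m = 0
  mem_iff : ∀ a, a ∈ I.1 ↔ a + m ∈ J.1

lemma Translates.refl (I : KSubset (n₀ * d) k) : Translates 0 I I :=
  ⟨map_zero _, fun a => by rw [add_zero]⟩

lemma Translates.trans {m m' : ZMod (n₀ * d)} (h : Translates m I J) (h' : Translates m' J K) :
    Translates (m + m') I K :=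
  ⟨by rw [map_add, h.red_eq_zero, h'.red_eq_zero, add_zero], fun a => by
    rw [h.mem_iff, h'.mem_iff, add_assoc]⟩

lemma Translates.symm {m : ZMod (n₀ * d)} (h : Translates m I J) : Translates (-m) J I :=
  ⟨by rw [map_neg, h.red_eq_zero, neg_zero], fun a => by
    rw [h.mem_iff, neg_add_cancel_right]⟩

lemma cls_eq_iff [NeZero n₀] [NeZero d] : cls n₀ I = cls n₀ J ↔ ∃ m, Translates m I J := by
  refine Quotient.eq.trans ⟨fun ⟨j, h⟩ => ⟨(j : ZMod (n₀ * d)) * n₀, ?_, h⟩, fun ⟨m, h⟩ => ?_⟩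
  · simp
  · have h0 : ((m.val : ℕ) : ZMod n₀) = 0 := by
      rw [← h.red_eq_zero, ← map_natCast (red n₀ d), ZMod.natCast_zmod_val]
    obtain ⟨q, hq⟩ := (ZMod.natCast_eq_zero_iff _ _).1 h0
    refine ⟨q, fun a => ?_⟩
    rw [h.mem_iff]
    have : m = ((q : ℤ) : ZMod (n₀ * d)) * n₀ := by
      rw [← ZMod.natCast_zmod_val m, hq]
      push_cast
      ring
    rw [this]

/-- The stabilizer of `I` in the group of the multiples of `n₀` modulo `n₀ d`. -/
def stab (I : KSubset (n₀ * d) k) : AddSubgroup (ZMod (n₀ * d)) where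
  carrier := {m | Translates m I I}
  zero_mem' := Translates.refl I
  add_mem' h h' := h.trans h'
  neg_mem' h := h.symm

/-- Since `I` and `J` have the same number of elements, it is enough that one is mapped into the
other. -/
lemma exists_mem_add_notMem {m : ZMod (n₀ * d)} (h0 : red n₀ d m = 0) (h : ¬ Translates m I J) :
    ∃ a ∈ I.1, a + m ∉ J.1 := by
  by_contra! hc
  refine h ⟨h0, fun a => ⟨hc a, fun ha => ?_⟩⟩
  have h1 : I.1.map (addRightEmbedding m) = J.1 := by
    refine Finset.eq_of_subset_of_card_le (fun b hb => ?_) (by rw [Finset.card_map, I.2, J.2])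
    obtain ⟨a, ha, rfl⟩ := Finset.mem_map.1 hb
    exact hc a ha
  rw [← h1] at ha
  obtain ⟨b, hb, hba⟩ := Finset.mem_map.1 ha
  rwa [← add_right_cancel (show b + m = a + m from hba)]

end Translations

/-! ### Residues of matrix entries modulo `t` -/

section Residues

variable {n₀ d k : ℕ} [NeZero n₀] [NeZero d] {hk : 0 < k} {hkn : k < n₀ * d}
  {I J K : KSubset (n₀ * d) k}

lemma tIf_ne_zero (p : Prop) : tIf p ≠ 0 := by
  unfold tIf
  split_ifs
  · exact PowerSeries.X_ne_zero
  · exact one_ne_zero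

lemma apply_add_eq_of_apply_sub_one {n : ℕ} [NeZero n] {α : Type*} {F : ZMod n → α}
    (h : ∀ a, F a = F (a - 1)) (a z : ZMod n) : F (a + z) = F a := by
  have hs : ∀ s : ℕ, F (a + s) = F a := by
    intro s
    induction s with
    | zero => rw [Nat.cast_zero, add_zero]
    | succ s ih => rw [h, ← ih]; push_cast; ring_nf
  rw [← ZMod.natCast_zmod_val z, hs]

lemma mat_add_add (f : L hk hkn I →ₗ[BG n₀ d k] L hk hkn J) {a b : ZMod (n₀ * d)}
    (h : Translates (b - a) I J) (z : ZMod (n₀ * d)) : mat f (b + z) (a + z) = mat f b a := by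
  have h1 : ∀ c, mat f (c + (b - a)) c = mat f (c - 1 + (b - a)) (c - 1) := by
    intro c
    refine mul_left_cancel₀ (tIf_ne_zero (c ∉ I.1)) ?_
    have h2 := tIf_mul_mat f c (c + (b - a))
    rw [← h.mem_iff, add_sub_right_comm] at h2
    exact h2
  have h3 := apply_add_eq_of_apply_sub_one (F := fun c => mat f (c + (b - a)) c) h1 a z
  simp only [add_sub_cancel] at h3
  rw [← h3]
  congr 1
  ring

/-- If `f : L_{[I]} → L_{[J]}` and `g : L_{[J]} → L_{[K]}` and `K` is a translate of `I`, then the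
products of corresponding entries of the two matrices do not depend on the position. Where `I`, but
not the translate of `J`, has an element, the entry of `f` is divisible by `t`. -/
lemma constantCoeff_mat_mul_mat (g : L hk hkn J →ₗ[BG n₀ d k] L hk hkn K)
    (f : L hk hkn I →ₗ[BG n₀ d k] L hk hkn J) {a b c : ZMod (n₀ * d)}
    (hca : Translates (c - a) I K) (hba : ¬ Translates (b - a) I J) :
    PowerSeries.constantCoeff (mat g c b * mat f b a) = 0 := by
  by_cases hred : red n₀ d b = red n₀ d a
  swap
  · rw [mat_eq_zero_of_red_ne f hred, mul_zero, map_zero]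
  obtain ⟨a', ha', hb'⟩ := exists_mem_add_notMem (by rw [map_sub, hred, sub_self]) hba
  have h1 : ∀ s, mat g (s + (c - a)) (s + (b - a)) * mat f (s + (b - a)) s =
      mat g (s - 1 + (c - a)) (s - 1 + (b - a)) * mat f (s - 1 + (b - a)) (s - 1) := by
    intro s
    have hf := tIf_mul_mat f s (s + (b - a))
    have hg := tIf_mul_mat g (s + (b - a)) (s + (c - a))
    rw [← hca.mem_iff, add_sub_right_comm, add_sub_right_comm s] at hg
    rw [add_sub_right_comm] at hf
    refine mul_left_cancel₀ (mul_ne_zero (tIf_ne_zero (s ∉ I.1))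
      (tIf_ne_zero (s + (b - a) ∉ J.1))) ?_
    linear_combination mat g (s + (c - a)) (s + (b - a)) * tIf (s + (b - a) ∉ J.1) * hf +
      tIf (s + (b - a) ∉ J.1) * mat f (s - 1 + (b - a)) (s - 1) * hg
  have h2 := apply_add_eq_of_apply_sub_one
    (F := fun s => mat g (s + (c - a)) (s + (b - a)) * mat f (s + (b - a)) s) h1 a (a' - a)
  simp only [add_sub_cancel] at h2
  have h3 := tIf_mul_mat f a' (a' + (b - a))
  have h4 : tIf (a' ∉ I.1) = 1 := if_neg (not_not.2 ha')
  have h5 : tIf (a' + (b - a) ∉ J.1) = PowerSeries.X := if_pos hb'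
  rw [h4, h5, one_mul] at h3
  rw [← h2, h3, map_mul, map_mul, PowerSeries.constantCoeff_X, zero_mul, mul_zero]

/-- Isomorphic modules belong to subsets of the same class: otherwise the products of matrix entries
that make up a diagonal entry of the identity matrix are divisible by `t`. -/
lemma cls_eq_of_linearEquiv (u : L hk hkn I ≃ₗ[BG n₀ d k] L hk hkn J) : cls n₀ I = cls n₀ J := by
  by_contra hne
  have hT : ∀ m, ¬ Translates m I J := fun m h => hne (cls_eq_iff.2 ⟨m, h⟩)
  have h1 : mat u.symm.toLinearMap * mat u.toLinearMap = 1 := by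
    rw [← mat_comp, ← mat_id (hk := hk) (hkn := hkn) (I := I)]
    congr 1
    exact LinearMap.ext fun v => u.symm_apply_apply v
  have h2 := congrArg PowerSeries.constantCoeff (congrFun (congrFun h1 0) 0)
  rw [Matrix.mul_apply, map_sum, Matrix.one_apply_eq, map_one,
    Finset.sum_eq_zero fun b _ => constantCoeff_mat_mul_mat _ _
      (by rw [sub_self]; exact Translates.refl I) (hT _)] at h2
  exact zero_ne_one h2

end Residues

/-! ### The isomorphism attached to a translation -/

lemma preAct_shift {n₀ d k : ℕ} [NeZero n₀] {I J : KSubset (n₀ * d) k}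
    {m : ZMod (n₀ * d)} (h : Translates m I J)
    (a : Preproj n₀) (v : Carrier n₀ d) (j : ZMod (n₀ * d)) :
    preAct n₀ d J.1 a (fun i => v (i - m)) j = preAct n₀ d I.1 a v (j - m) := by
  suffices hs : preAct n₀ d J.1 a ∘ₗ LinearMap.funLeft ℂ⟦X⟧ ℂ⟦X⟧ (· - m) =
      LinearMap.funLeft ℂ⟦X⟧ ℂ⟦X⟧ (· - m) ∘ₗ preAct n₀ d I.1 a from
    congrFun (LinearMap.congr_fun hs v) j
  obtain ⟨b, rfl⟩ := RingQuot.mkAlgHom_surjective ℂ (Rel n₀) a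
  have hb : ∀ I, preAct n₀ d I (RingQuot.mkAlgHom ℂ (Rel n₀) b) =
      FreeAlgebra.lift ℂ (genAct n₀ d I) b := fun I => by
    unfold preAct
    erw [RingQuot.liftAlgHom_mkAlgHom_apply]
  rw [hb, hb]
  clear hb v j
  have hred : ∀ j, red n₀ d (j - m) = red n₀ d j := fun j => by
    rw [map_sub, h.red_eq_zero, sub_zero]
  have hmem : ∀ j, j - m ∈ I.1 ↔ j ∈ J.1 := fun j => by rw [h.mem_iff, sub_add_cancel]
  induction b using FreeAlgebra.induction with
  | grade0 r =>
    rw [AlgHom.commutes, AlgHom.commutes]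
    rfl
  | grade1 g =>
    rw [FreeAlgebra.lift_ι_apply, FreeAlgebra.lift_ι_apply]
    refine LinearMap.ext fun v => funext fun j => ?_
    cases g with
    | e i =>
      change (if red n₀ d j = i then v (j - m) else 0) =
        if red n₀ d (j - m) = i then v (j - m) else 0
      rw [hred]
    | x i =>
      change (if red n₀ d j = i then tIf (j ∉ J.1) * v (j - 1 - m) else 0) =
        if red n₀ d (j - m) = i then tIf (j - m ∉ I.1) * v (j - m - 1) else 0
      rw [hred, hmem, sub_right_comm]
    | y i =>
      change (if red n₀ d (j + 1) = i then tIf (j + 1 ∈ J.1) * v (j + 1 - m) else 0) =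
        if red n₀ d (j - m + 1) = i then tIf (j - m + 1 ∈ I.1) * v (j - m + 1) else 0
      rw [← add_sub_right_comm, hred, hmem]
  | mul a b ha hb =>
    rw [map_mul, map_mul, Module.End.mul_eq_comp, Module.End.mul_eq_comp, LinearMap.comp_assoc, hb,
      ← LinearMap.comp_assoc, ha, LinearMap.comp_assoc]
  | add a b ha hb =>
    rw [map_add, map_add, LinearMap.add_comp, LinearMap.comp_add, ha, hb]

section Shift

variable {n₀ d k : ℕ} [NeZero n₀] [NeZero d] {hk : 0 < k} {hkn : k < n₀ * d}
  {I J : KSubset (n₀ * d) k}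

lemma coeff_mk_smul (b : CompletePreproj n₀) (v : L hk hkn I) (j : ZMod (n₀ * d)) (c : ℕ) :
    PowerSeries.coeff c ((BG.mk n₀ d k b • v) j) = PowerSeries.coeff c
      (preAct n₀ d I.1 (repr (𝔪 := arrowIdeal n₀) b (level n₀ d c)) (v : Carrier n₀ d) j) :=
  coeff_extFun (𝔪 := arrowIdeal n₀) (preAct_continuous I.1 I.2 hk hkn) b c _ (mk_repr _ _) v j

/-- The isomorphism `𝟏_a ↦ 𝟏_{a + m}`. It commutes with the uncompleted preprojective algebra, and
hence with its completion, whose action is defined one coefficient at a time. -/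
def shift {m : ZMod (n₀ * d)} (h : Translates m I J) :
    L hk hkn I ≃ₗ[BG n₀ d k] L hk hkn J where
  toFun v := fun j => v (j - m)
  invFun v := fun j => v (j + m)
  left_inv v := funext fun j => congrArg v (add_sub_cancel_right j m)
  right_inv v := funext fun j => congrArg v (sub_add_cancel j m)
  map_add' _ _ := rfl
  map_smul' a v := by
    obtain ⟨b, rfl⟩ := Ideal.Quotient.mk_surjective a
    funext j
    ext c
    change PowerSeries.coeff c ((BG.mk n₀ d k b • v) (j - m)) =
      PowerSeries.coeff c ((BG.mk n₀ d k b • (show L hk hkn J from fun i => v (i - m))) j)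
    rw [coeff_mk_smul, coeff_mk_smul]
    exact congrArg (PowerSeries.coeff c) (preAct_shift h _ (v : Carrier n₀ d) j).symm

lemma mat_shift {m : ZMod (n₀ * d)} (h : Translates m I J) (a b : ZMod (n₀ * d)) :
    mat (shift h : L hk hkn I ≃ₗ[BG n₀ d k] L hk hkn J).toLinearMap b a =
      if b - m = a then 1 else 0 :=
  Pi.single_apply a (1 : ℂ⟦X⟧) (b - m)

theorem nonempty_linearEquiv_iff :
    Nonempty (L hk hkn I ≃ₗ[BG n₀ d k] L hk hkn J) ↔ cls n₀ I = cls n₀ J := by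
  refine ⟨fun ⟨u⟩ => cls_eq_of_linearEquiv u, fun h => ?_⟩
  obtain ⟨m, hm⟩ := cls_eq_iff.1 h
  exact ⟨shift hm⟩

end Shift

/-! ### Idempotents of characters -/

section Characters

variable {A H : Type*} [Ring A] [Algebra ℂ A] [AddCommGroup H] [Fintype H]

/-- The idempotent `|H|⁻¹ ∑ ψ(-m) σ(m)` of the character `ψ`, in an algebra on which the finite
abelian group `H` is represented by `σ`. -/
def charIdem (σ : AddChar H A) (ψ : AddChar H ℂ) : A :=
  ∑ m, ((Fintype.card H : ℂ)⁻¹ * ψ (-m)) • σ m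

lemma charIdem_mul (σ : AddChar H A) (ψ : AddChar H ℂ) (m : H) :
    charIdem σ ψ * σ m = ψ m • charIdem σ ψ := by
  rw [charIdem, Finset.sum_mul, Finset.smul_sum]
  refine Fintype.sum_equiv (Equiv.addRight m) _ _ fun m' => ?_
  rw [Equiv.coe_addRight, smul_mul_assoc, ← AddChar.map_add_eq_mul, smul_smul]
  congr 1
  rw [mul_left_comm, ← AddChar.map_add_eq_mul, neg_add_rev, add_neg_cancel_left]

lemma inv_card_mul_sum_eq_ite (ψ ψ' : AddChar H ℂ) :
    ∑ m, (Fintype.card H : ℂ)⁻¹ * ψ' (-m) * ψ m = if ψ = ψ' then 1 else 0 := by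
  have h : ∀ m, (Fintype.card H : ℂ)⁻¹ * ψ' (-m) * ψ m =
      (Fintype.card H : ℂ)⁻¹ * (ψ - ψ') m := fun m => by
    rw [AddChar.sub_apply, mul_assoc, mul_comm (ψ' _)]
  simp_rw [h]
  rw [← Finset.mul_sum, AddChar.sum_eq_ite]
  simp only [sub_eq_zero]
  split_ifs
  · exact inv_mul_cancel₀ (Nat.cast_ne_zero.2 Fintype.card_ne_zero)
  · exact mul_zero _

lemma charIdem_mul_charIdem (σ : AddChar H A) (ψ ψ' : AddChar H ℂ) :
    charIdem σ ψ * charIdem σ ψ' = if ψ = ψ' then charIdem σ ψ else 0 := by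
  conv_lhs => rw [charIdem.eq_def σ ψ', Finset.mul_sum]
  simp_rw [mul_smul_comm, charIdem_mul, smul_smul]
  rw [← Finset.sum_smul, inv_card_mul_sum_eq_ite, ite_smul, one_smul, zero_smul]

lemma sum_charIdem (σ : AddChar H A) : ∑ ψ : AddChar H ℂ, charIdem σ ψ = 1 := by
  classical
  simp_rw [charIdem]
  rw [Finset.sum_comm]
  simp_rw [← Finset.sum_smul, ← Finset.mul_sum, AddChar.sum_apply_eq_ite, neg_eq_zero]
  rw [Finset.sum_eq_single 0 (fun m _ hm => by rw [if_neg hm, mul_zero, zero_smul])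
    (fun h => absurd (Finset.mem_univ _) h), if_pos rfl,
    inv_mul_cancel₀ (Nat.cast_ne_zero.2 Fintype.card_ne_zero), one_smul, AddChar.map_zero_eq_one]

end Characters

/-! ### Idempotent matrices over `ℂ⟦t⟧` -/

/-- Modulo `t` the trace is the rank; an idempotent matrix that vanishes modulo `t` is annihilated by
the invertible matrix `1 - P`. -/
lemma eq_zero_of_isIdempotentElem_of_diag {ι : Type*} [Fintype ι] [DecidableEq ι]
    {P : Matrix ι ι ℂ⟦X⟧} (hP : IsIdempotentElem P)
    (h : ∀ i, PowerSeries.constantCoeff (P i i) = 0) : P = 0 := by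
  let φ : Matrix ι ι ℂ⟦X⟧ →+* Matrix ι ι ℂ := (PowerSeries.constantCoeff (R := ℂ)).mapMatrix
  have h1 : φ P = 0 := by
    refine (Matrix.toLin'.map_eq_zero_iff).1 ?_
    refine (LinearMap.IsIdempotentElem.trace_eq_zero_iff ?_).1 ?_
    · change Matrix.toLin' (φ P) * Matrix.toLin' (φ P) = _
      rw [Module.End.mul_eq_comp, ← Matrix.toLin'_mul, ← map_mul, hP.eq]
    · rw [Matrix.trace_toLin'_eq]
      exact Finset.sum_eq_zero fun i _ => h i
  have h2 : IsUnit (1 - P) := by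
    rw [Matrix.isUnit_iff_isUnit_det, PowerSeries.isUnit_iff_constantCoeff, RingHom.map_det]
    change IsUnit (φ (1 - P)).det
    rw [map_sub, h1, map_one, sub_zero, Matrix.det_one]
    exact isUnit_one
  refine h2.mul_left_cancel ?_
  rw [sub_mul, one_mul, hP.eq, sub_self, mul_zero]

/-! ### The endomorphism ring of a sum of modules `L_{[I]}` -/

section EndomorphismRing

variable {n₀ d k : ℕ} [NeZero n₀] [NeZero d] {hk : 0 < k} {hkn : k < n₀ * d}

instance (I : KSubset (n₀ * d) k) : Module ℂ (L hk hkn I) :=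
  inferInstanceAs (Module ℂ (Carrier n₀ d))

instance (I : KSubset (n₀ * d) k) : IsScalarTower ℂ (BG n₀ d k) (L hk hkn I) :=
  ⟨fun c a v => by
    have h : ∀ w : L hk hkn I, algebraMap ℂ (BG n₀ d k) c • w = c • w := fun w =>
      (algebraMap_smul c w).trans (funext fun j => (PowerSeries.smul_eq_C_mul _ _).symm)
    rw [Algebra.smul_def, mul_smul, h]⟩

instance (I : KSubset (n₀ * d) k) : SMulCommClass (BG n₀ d k) ℂ (L hk hkn I) :=
  IsScalarTower.to_smulCommClass'

instance (I : KSubset (n₀ * d) k) : Fintype (stab I) := Fintype.ofFinite _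

/-- The stabilizer of `I` acts on `L_{[I]}`. -/
def stabAct (I : KSubset (n₀ * d) k) :
    AddChar (stab I) (Module.End (BG n₀ d k) (L hk hkn I)) where
  toFun m := (shift m.2 : L hk hkn I ≃ₗ[BG n₀ d k] L hk hkn I).toLinearMap
  map_zero_eq_one' := LinearMap.ext fun v => funext fun j => congrArg v (sub_zero j)
  map_add_eq_mul' m m' := LinearMap.ext fun v => funext fun j =>
    congrArg v (sub_add_eq_sub_sub j (m : ZMod (n₀ * d)) m')

variable {S : Type*} [Fintype S] [DecidableEq S] {I : S → KSubset (n₀ * d) k}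

/-- The components of an endomorphism of a finite product of modules `L_{[I]}`. -/
def component (h : Module.End (BG n₀ d k) (∀ c, L hk hkn (I c))) (c c' : S) :
    L hk hkn (I c') →ₗ[BG n₀ d k] L hk hkn (I c) :=
  LinearMap.proj c ∘ₗ h ∘ₗ LinearMap.single (BG n₀ d k) (fun c => L hk hkn (I c)) c'

lemma component_mul (g h : Module.End (BG n₀ d k) (∀ c, L hk hkn (I c))) (c c' : S) :
    component (g * h) c c' = ∑ b, component g c b ∘ₗ component h b c' := by
  refine LinearMap.ext fun v => ?_
  rw [LinearMap.sum_apply]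
  change g (h (Pi.single c' v)) c = ∑ b, g (Pi.single b (h (Pi.single c' v) b)) c
  conv_lhs => rw [← Finset.univ_sum_single (h (Pi.single c' v)), map_sum, Finset.sum_apply]

/-- The matrix of an endomorphism of a finite product of modules `L_{[I]}`. -/
def matHom : Module.End (BG n₀ d k) (∀ c, L hk hkn (I c)) →+*
    Matrix (S × ZMod (n₀ * d)) (S × ZMod (n₀ * d)) ℂ⟦X⟧ where
  toFun h := Matrix.of fun p q => mat (component h p.1 q.1) p.2 q.2
  map_zero' := rfl
  map_add' _ _ := rfl
  map_one' := by
    ext1 p q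
    obtain ⟨c, a⟩ := p
    obtain ⟨c', b⟩ := q
    by_cases h : c = c'
    · subst h
      have h1 : component (1 : Module.End (BG n₀ d k) (∀ c, L hk hkn (I c))) c c = LinearMap.id :=
        LinearMap.ext fun v => Pi.single_eq_same (M := fun c => L hk hkn (I c)) c v
      rw [Matrix.of_apply, h1, mat_id]
      simp only [Matrix.one_apply, Prod.mk.injEq, true_and]
    · have h1 : component (1 : Module.End (BG n₀ d k) (∀ c, L hk hkn (I c))) c c' = 0 :=
        LinearMap.ext fun v => Pi.single_eq_of_ne (M := fun c => L hk hkn (I c)) h v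
      rw [Matrix.of_apply, h1, Matrix.one_apply_ne fun h' => h (congrArg Prod.fst h')]
      rfl
  map_mul' g h := by
    ext1 p q
    rw [Matrix.of_apply, component_mul, mat_sum, Matrix.mul_apply, Fintype.sum_prod_type,
      Matrix.sum_apply]
    simp_rw [mat_comp]
    rfl

lemma matHom_injective : Function.Injective (matHom (hk := hk) (hkn := hkn) (I := I)) := by
  refine (injective_iff_map_eq_zero _).2 fun h h0 => ?_
  refine LinearMap.pi_ext fun c' v => funext fun c => funext fun j => ?_
  have h1 := map_apply_eq_sum (component h c c') v j
  rw [Finset.sum_eq_zero fun a _ => by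
    rw [show mat (component h c c') j a = 0 from congrFun (congrFun h0 (c, j)) (c', a),
      zero_mul]] at h1
  exact h1

/-- The functional `∑ ψ(m) χ_m` on the endomorphism ring, where `χ_m` is the residue modulo `t` of
the matrix entry that sends `𝟏_0` to `𝟏_m` in `L_{[I c]}`. -/
def charFun (c : S) (ψ : AddChar (stab (I c)) ℂ)
    (h : Module.End (BG n₀ d k) (∀ c, L hk hkn (I c))) : ℂ :=
  ∑ m : stab (I c), ψ m * PowerSeries.constantCoeff (matHom h (c, (m : ZMod (n₀ * d))) (c, 0))

lemma constantCoeff_matHom_mul (hI : ∀ c c', cls n₀ (I c) = cls n₀ (I c') → c = c')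
    (g h : Module.End (BG n₀ d k) (∀ c, L hk hkn (I c))) (c : S) (m : stab (I c)) :
    PowerSeries.constantCoeff (matHom (g * h) (c, (m : ZMod (n₀ * d))) (c, 0)) =
      ∑ b : stab (I c),
        PowerSeries.constantCoeff (matHom g (c, ((m - b : stab (I c)) : ZMod (n₀ * d))) (c, 0)) *
        PowerSeries.constantCoeff (matHom h (c, (b : ZMod (n₀ * d))) (c, 0)) := by
  rw [map_mul, Matrix.mul_apply, map_sum]
  refine (Finset.sum_of_injOn (fun b : stab (I c) => (c, (b : ZMod (n₀ * d)))) ?_ ?_ ?_ ?_).symm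
  · exact fun b _ b' _ hb => Subtype.ext (congrArg Prod.snd hb)
  · exact fun _ _ => Finset.mem_coe.2 (Finset.mem_univ _)
  · rintro ⟨c', b⟩ _ hb
    refine constantCoeff_mat_mul_mat (component g c c') (component h c' c)
      (by rw [sub_zero]; exact m.2) fun hT => hb ?_
    rw [sub_zero] at hT
    obtain rfl := hI c c' (cls_eq_iff.2 ⟨b, hT⟩)
    exact ⟨⟨b, hT⟩, Finset.mem_coe.2 (Finset.mem_univ _), rfl⟩
  · intro b _
    have h1 := mat_add_add (component g c c) (a := 0) (b := ((m - b : stab (I c)) : ZMod (n₀ * d)))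
      (by rw [sub_zero]; exact (m - b).2) b
    rw [zero_add, AddSubgroup.coe_sub, sub_add_cancel] at h1
    rw [map_mul]
    congr 2
    exact h1.symm

/-- The functionals attached to characters are multiplicative, since the residues modulo `t` of
products of matrix entries vanish unless the entries correspond to elements of stabilizers. -/
def charHom (hI : ∀ c c', cls n₀ (I c) = cls n₀ (I c') → c = c') (c : S)
    (ψ : AddChar (stab (I c)) ℂ) : Module.End (BG n₀ d k) (∀ c, L hk hkn (I c)) →+* ℂ where
  toFun := charFun c ψ
  map_zero' := by simp [charFun]
  map_add' g h := by simp [charFun, mul_add, Finset.sum_add_distrib]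
  map_one' := by
    rw [charFun, map_one, Finset.sum_eq_single 0]
    · rw [AddChar.map_zero_eq_one, one_mul]
      exact (congrArg _ (Matrix.one_apply_eq (c, (0 : ZMod (n₀ * d))))).trans (map_one _)
    · intro m _ hm
      have hne : ((c, (m : ZMod (n₀ * d))) : S × ZMod (n₀ * d)) ≠ (c, 0) := fun h =>
        hm (Subtype.ext (congrArg Prod.snd h))
      rw [Matrix.one_apply_ne hne, map_zero, mul_zero]
    · exact fun h => absurd (Finset.mem_univ _) h
  map_mul' g h := by
    simp_rw [charFun, constantCoeff_matHom_mul hI, Finset.mul_sum]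
    rw [Finset.sum_comm]
    refine Finset.sum_congr rfl fun b _ => ?_
    rw [Finset.sum_mul]
    refine Fintype.sum_equiv (Equiv.subRight b) _ _ fun m => ?_
    have hψ : ψ m = ψ (m - b) * ψ b := by rw [← AddChar.map_add_eq_mul, sub_add_cancel]
    rw [Equiv.subRight_apply, hψ]
    ring

/-- The idempotent of the character `ψ` of the stabilizer of `I c`, as an endomorphism of the product
that is zero on the other factors. -/
def charProj (c : S) (ψ : AddChar (stab (I c)) ℂ) :
    Module.End (BG n₀ d k) (∀ c, L hk hkn (I c)) :=
  LinearMap.single (BG n₀ d k) (fun c => L hk hkn (I c)) c ∘ₗ charIdem (stabAct (I c)) ψ ∘ₗ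
    LinearMap.proj c

lemma completeOrthogonalIdempotents_charProj :
    CompleteOrthogonalIdempotents fun i : (Σ c, AddChar (stab (I c)) ℂ) =>
      (charProj i.1 i.2 : Module.End (BG n₀ d k) (∀ c, L hk hkn (I c))) := by
  have hmul : ∀ (c : S) (ψ ψ' : AddChar (stab (I c)) ℂ),
      (charProj c ψ * charProj c ψ' : Module.End (BG n₀ d k) (∀ c, L hk hkn (I c))) =
        if ψ = ψ' then charProj c ψ else 0 := by
    intro c ψ ψ'
    have h1 : (charProj c ψ * charProj c ψ' : Module.End (BG n₀ d k) (∀ c, L hk hkn (I c))) =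
        LinearMap.single (BG n₀ d k) (fun c => L hk hkn (I c)) c ∘ₗ
          (charIdem (stabAct (I c)) ψ * charIdem (stabAct (I c)) ψ') ∘ₗ LinearMap.proj c := by
      refine LinearMap.ext fun v => ?_
      change Pi.single (M := fun c => L hk hkn (I c)) c (charIdem (stabAct (I c)) ψ
        ((Pi.single c (charIdem (stabAct (I c)) ψ' (v c)) : ∀ c, L hk hkn (I c)) c)) = _
      rw [Pi.single_eq_same]
      rfl
    rw [h1, charIdem_mul_charIdem]
    split_ifs
    · rfl
    · rw [LinearMap.zero_comp, LinearMap.comp_zero]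
  refine ⟨⟨fun i => ?_, ?_⟩, ?_⟩
  · exact (hmul i.1 i.2 i.2).trans (if_pos rfl)
  · rintro ⟨c, ψ⟩ ⟨c', ψ'⟩ hne
    by_cases h : c = c'
    · subst h
      exact (hmul c ψ ψ').trans (if_neg fun h => hne (by rw [h]))
    · refine LinearMap.ext fun v => ?_
      change Pi.single (M := fun c => L hk hkn (I c)) c (charIdem (stabAct (I c)) ψ
        ((Pi.single c' (charIdem (stabAct (I c')) ψ' (v c')) : ∀ c, L hk hkn (I c)) c)) = 0
      rw [Pi.single_eq_of_ne h, map_zero, Pi.single_zero]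
  · rw [Fintype.sum_sigma]
    refine LinearMap.ext fun v => ?_
    rw [LinearMap.sum_apply, Module.End.one_apply]
    conv_rhs => rw [← Finset.univ_sum_single v]
    refine Finset.sum_congr rfl fun c _ => ?_
    rw [LinearMap.sum_apply]
    change ∑ ψ, LinearMap.single (BG n₀ d k) (fun c => L hk hkn (I c)) c
      (charIdem (stabAct (I c)) ψ (v c)) = _
    rw [← map_sum, ← LinearMap.sum_apply, sum_charIdem]
    rfl

lemma constantCoeff_mat_charIdem (I : KSubset (n₀ * d) k) (ψ : AddChar (stab I) ℂ) (m : stab I) :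
    PowerSeries.constantCoeff (mat (charIdem (stabAct (hk := hk) (hkn := hkn) I) ψ) m 0) =
      (Fintype.card (stab I) : ℂ)⁻¹ * ψ (-m) := by
  have hsmul : ∀ (z : ℂ) (m' : stab I), mat (z • stabAct (hk := hk) (hkn := hkn) I m') m 0 =
      z • if (m : ZMod (n₀ * d)) - m' = 0 then (1 : ℂ⟦X⟧) else 0 := fun z m' =>
    congrArg (z • ·) (mat_shift (hk := hk) (hkn := hkn) m'.2 0 (m : ZMod (n₀ * d)))
  rw [charIdem, mat_sum, Matrix.sum_apply]
  simp_rw [hsmul]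
  rw [Finset.sum_eq_single m]
  · rw [sub_self, if_pos rfl, PowerSeries.smul_eq_C_mul, mul_one, PowerSeries.constantCoeff_C]
  · intro m' _ hm
    rw [if_neg fun h => hm (Subtype.ext (sub_eq_zero.1 h).symm), smul_zero]
  · exact fun h => absurd (Finset.mem_univ _) h

lemma charHom_charProj (hI : ∀ c c', cls n₀ (I c) = cls n₀ (I c') → c = c')
    (i j : Σ c, AddChar (stab (I c)) ℂ) :
    charHom (hk := hk) (hkn := hkn) hI i.1 i.2 (charProj j.1 j.2) = if i = j then 1 else 0 := by
  obtain ⟨c, ψ⟩ := i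
  obtain ⟨c', ψ'⟩ := j
  change ∑ m : stab (I c), ψ m * PowerSeries.constantCoeff
    (mat (component (charProj c' ψ') c c) (m : ZMod (n₀ * d)) 0) = _
  by_cases h : c = c'
  · subst h
    have h1 : component (hk := hk) (hkn := hkn) (charProj c ψ') c c =
        charIdem (stabAct (I c)) ψ' := by
      refine LinearMap.ext fun v => ?_
      change (Pi.single c (charIdem (stabAct (I c)) ψ'
        ((Pi.single c v : ∀ c, L hk hkn (I c)) c)) : ∀ c, L hk hkn (I c)) c = _
      rw [Pi.single_eq_same, Pi.single_eq_same]
    simp_rw [h1, constantCoeff_mat_charIdem, mul_comm (ψ _)]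
    rw [inv_card_mul_sum_eq_ite]
    simp
  · have h1 : component (hk := hk) (hkn := hkn) (charProj c' ψ') c c = 0 :=
      LinearMap.ext fun v => Pi.single_eq_of_ne h _
    rw [if_neg fun h' => h (congrArg Sigma.fst h'), h1]
    exact Finset.sum_eq_zero fun m _ => by
      rw [show mat (0 : L hk hkn (I c) →ₗ[BG n₀ d k] L hk hkn (I c)) m 0 = 0 from rfl, map_zero,
        mul_zero]

/-- The sum over all characters of a stabilizer singles out the residue `χ_0`, so that the diagonal
entries of the matrix of such an idempotent vanish modulo `t`. -/
lemma eq_zero_of_charHom_eq_zero (hI : ∀ c c', cls n₀ (I c) = cls n₀ (I c') → c = c')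
    (p : Module.End (BG n₀ d k) (∀ c, L hk hkn (I c))) (hp : IsIdempotentElem p)
    (h : ∀ (c : S) (ψ : AddChar (stab (I c)) ℂ), charHom hI c ψ p = 0) : p = 0 := by
  refine matHom_injective ?_
  rw [map_zero]
  refine eq_zero_of_isIdempotentElem_of_diag (hp.map matHom) ?_
  rintro ⟨c, a⟩
  have h0 : PowerSeries.constantCoeff (matHom p (c, 0) (c, 0)) = 0 := by
    have h1 : ∑ ψ : AddChar (stab (I c)) ℂ, charHom hI c ψ p = 0 :=
      Finset.sum_eq_zero fun ψ _ => h c ψ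
    change ∑ ψ : AddChar (stab (I c)) ℂ, ∑ m : stab (I c), ψ m *
      PowerSeries.constantCoeff (matHom p (c, (m : ZMod (n₀ * d))) (c, 0)) = 0 at h1
    rw [Finset.sum_comm] at h1
    simp_rw [← Finset.sum_mul, AddChar.sum_apply_eq_ite] at h1
    rw [Finset.sum_eq_single 0 (fun m _ hm => by rw [if_neg hm, zero_mul])
      (fun h => absurd (Finset.mem_univ _) h), if_pos rfl] at h1
    exact (mul_eq_zero.1 h1).resolve_left (Nat.cast_ne_zero.2 Fintype.card_ne_zero)
  have h2 := mat_add_add (component p c c) (a := 0) (b := 0)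
    (by rw [sub_zero]; exact Translates.refl _) a
  rw [zero_add] at h2
  exact (congrArg PowerSeries.constantCoeff h2).trans h0

theorem isBasic_directSum {S : Type*} [Finite S] {I : S → KSubset (n₀ * d) k}
    (hI : ∀ c c', cls n₀ (I c) = cls n₀ (I c') → c = c') :
    IsBasic (BG n₀ d k) (DirectSum S fun c => L hk hkn (I c)) := by
  classical
  have := Fintype.ofFinite S
  exact isBasic_of_linearEquiv_of_characters
    (DirectSum.linearEquivFunOnFintype (BG n₀ d k) S fun c => L hk hkn (I c))
    completeOrthogonalIdempotents_charProj (fun i => charHom hI i.1 i.2)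
    (fun i j => charHom_charProj hI i j)
    fun p hp h => eq_zero_of_charHom_eq_zero hI p hp fun c ψ => h ⟨c, ψ⟩

end EndomorphismRing

end OrbifoldDiagrams

end

theorem mainTheorem8 (n₀ d k : ℕ) [NeZero n₀] [NeZero d] (hk : 0 < k) (hkn : k < n₀ * d) :
    (∀ I J : OrbifoldDiagrams.KSubset (n₀ * d) k,
      Nonempty (OrbifoldDiagrams.L hk hkn I ≃ₗ[OrbifoldDiagrams.BG n₀ d k]
          OrbifoldDiagrams.L hk hkn J) ↔
        OrbifoldDiagrams.cls n₀ I = OrbifoldDiagrams.cls n₀ J) ∧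
    (∀ O : OrbifoldDiagrams.OrbifoldDiagram n₀ d, O.IsGrassmannian k →
      OrbifoldDiagrams.IsBasic (OrbifoldDiagrams.BG n₀ d k) (O.T hk hkn)) := by
  refine ⟨fun I J => OrbifoldDiagrams.nonempty_linearEquiv_iff, fun O _ => ?_⟩
  refine OrbifoldDiagrams.isBasic_directSum fun c c' h => Subtype.ext ?_
  exact (Quotient.out_eq c.1).symm.trans (h.trans (Quotient.out_eq c'.1))
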